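/- **Model.** For each sample size $n$ consider $\mathbf y=\mathbf X\boldsymbol\beta^*+\boldsymbol\varepsilon$ with $\boldsymbol\varepsilon\sim\mathcal N(\mathbf 0,\sigma^2\mathbb I_n)$, $\sigma>0$ fixed, where $\mathbf X=[\mathbf 1,\mathbf X_0,\mathbf X_1,\dots,\mathbf X_l]$ has an intercept column, $p_0$ columns $\mathbf X_0$ of continuous regressors, and for each factor $k=1,\dots,l$ with levels $1,\dots,p_k$ the zero-one dummy coding $\mathbf X_k$ with reference level $1$. The parameter vector $\boldsymbol\beta=(\beta_{00},(\beta_{j0})_{1\le j\le p_0},(\beta_{jk})_{2\le j\le p_k,1\le k\le l})$ has length $p=p_n=1+p_0+\sum_{k=1}^l(p_k-1)$; put $\beta_{1k}=0$ for $k\ge1$. The numbers $p_0,l,p_k$, the matrix $\mathbf X$ and $\boldsymbol\beta^*$ may depend on $n$, and $\mathbf X$ has rank $p_n$ for all large $n$. **Feasible models.** A feasible model $M=(P_0,P_1,\dots,P_l)$ consists of a subset $P_0$ of the continuous regressors and a partition $P_k$ of the levels of each factor $k$. Its parameter space $\mathcal L_M$ is the set of $\boldsymbol\beta\in\mathbb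 R^p$ with $\beta_{j0}=0$ for $1\le j\le p_0$, $j\notin P_0$, and $\beta_{ik}=\beta_{jk}$ whenever $i,j$ lie in the same cluster of $P_k$. Its size is $|M|=\dim\mathcal L_M$, and $F$ is the full model, $\mathcal L_F=\mathbb R^p$. Let $\mathbf A^1_M$ be the $p\times|M|$ zero-one matrix whose columns are the indicators of the intercept, of each $j\in P_0$, and of each cluster not containing the reference level; its columns form a basis of $\mathcal L_M$. Put $\mathbf Z_M=\mathbf X\mathbf A^1_M$, $\widehat{\boldsymbol\beta}_M=\mathbf A^1_M(\mathbf Z_M^T\mathbf Z_M)^{-1}\mathbf Z_M^T\mathbf y$, $\mathbf H_M=\mathbf Z_M(\mathbf Z_M^T\mathbf Z_M)^{-1}\mathbf Z_M^T$, $RSS_M=\|\mathbf y-\mathbf X\widehat{\boldsymbol\beta}_M\|^2$, $GIC_M=n\log RSS_M+r_n|M|$ and $\Delta_M=\boldsymbol\beta^{*T}\mathbf X^T(\mathbb I-\mathbf H_M)\mathbf X\boldsymbol\beta^*$. Let $T=T_n$ be the feasible model of minimal size with $\boldsymbol\beta^*\in\mathcal L_T$, and let $\Delta=\min\{\Delta_M:\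 |M|=|F|-1,\ \mathcal L_T\not\subseteq\mathcal L_M\}$ (with $\Delta=\infty$ if there is no such $M$). **Procedure (DMR).** Let $\widehat{\boldsymbol\beta}=(\mathbf X^T\mathbf X)^{-1}\mathbf X^T\mathbf y$, $\widehat\sigma^2=\|\mathbf y-\mathbf X\widehat{\boldsymbol\beta}\|^2/(n-p)$, and for a constraint $\mathbf a^T\boldsymbol\beta=0$ let $t^2(\mathbf a)=(\mathbf a^T\widehat{\boldsymbol\beta})^2/(\widehat\sigma^2\,\mathbf a^T(\mathbf X^T\mathbf X)^{-1}\mathbf a)$. 1. For each factor $k$ cluster its levels agglomeratively. Start from singletons, with distance between $\{i\}$ and $\{j\}$ equal to $t^2$ of the constraint $\beta_{ik}=\beta_{jk}$. In each step merge two clusters $C,C'$ at minimal distance; this distance is the cutting height of the step, and the step gives the constraint $\beta_{ik}=\beta_{jk}$ with $i=\min C$, $j=\min C'$. The distance from $C\cup C'$ to any other cluster $E$ is $b\min\{d(C,E),d(C',E)\}+(1-b)\max\{d(C,E),d(C',E)\}$ with $b\in[0,1]$, where $b$ may be constant or vary from one update to another. 2. Sort the $p-1$ constraints, namely $\beta_{j0}=0$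 with height $t^2$ ($1\le j\le p_0$) and those from the merging steps with their cutting heights, by increasing height; let $M_m$ be the feasible model defined by the first $m$ of them, $0\le m\le p-1$. 3. $\widehat T$ is a minimizer of $GIC_{M_m}$ over $0\le m\le p-1$. Ties are broken in any (measurable) way. **Theorem.** Assume that the true model is fixed or, more generally, that $\sup_n|T_n|<\infty$, and that $p_n=o(r_n)$ and $r_n=o(\min(n,\Delta))$, with $r_n>0$. Then: (a) $\lim_{n\to\infty}\mathbb P(\widehat T=T)=1$. (b) If in addition $p_0$, $l$, all $p_k$ (hence $p$) and $T$ do not depend on $n$, and $\frac1n\mathbf X^T\mathbf X\to\boldsymbol\Sigma$ with $\boldsymbol\Sigma$ positive definite, then $$\sqrt n\,(\widehat{\boldsymbol\beta}_{\widehat T}-\boldsymbol\beta^*)\xrightarrow{d}\mathcal N(\mathbf 0,\sigma^2\boldsymbol\Sigma_T),\qquad \boldsymbol\Sigma_T=\mathbf A^1_T(\mathbf A_T^{1T}\boldsymbol\Sigma\mathbf A^1_T)^{-1}\mathbf A_T^{1T}.$$ -/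

import Mathlib

open MeasureTheory ProbabilityTheory Filter Topology
open scoped Matrix ENNReal NNReal

noncomputable section

namespace DMR

/-! ### The linear model with continuous regressors and factors -/

/-- Numbers of continuous regressors, of factors, and of non-reference levels of each factor.
Factor `k` has `extraLevels k + 1` levels, level `0` being the reference level. -/
structure Layout where
  numCont : ℕ
  numFactors : ℕ
  extraLevels : Fin numFactors → ℕ

namespace Layout

variable (L : Layout)

/-- The levels of factor `k`; the reference level is `0`. -/
abbrev Level (k : Fin L.numFactors) : Type := Fin (L.extraLevels k + 1)

/-- The elementary constraints produced along the procedure: one for each continuous regressor,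
one for each merging step of each factor. -/
abbrev Step : Type := Fin L.numCont ⊕ (Σ k : Fin L.numFactors, Fin (L.extraLevels k))

/-- Index set of the parameter vector: intercept, coefficients of the continuous regressors,
coefficients of the non-reference levels of the factors. -/
abbrev Param : Type :=
  Unit ⊕ (Fin L.numCont ⊕ (Σ k : Fin L.numFactors, Fin (L.extraLevels k)))

/-- The number `p` of parameters. -/
def numParams : ℕ := Fintype.card L.Param

/-- The vector picking the coefficient of a continuous regressor. -/
def contVec (j : Fin L.numCont) : L.Param → ℝ := Pi.single (Sum.inr (Sum.inl j)) 1

/-- The vector picking the coefficient of a level of factor `k`; the coefficient of the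
reference level is `0`. -/
def levelVec (k : Fin L.numFactors) : L.Level k → L.Param → ℝ :=
  Fin.cases 0 (fun j => Pi.single (Sum.inr (Sum.inr ⟨k, j⟩)) 1)

end Layout

/-- `n` observations: values of the continuous regressors and levels of the factors. -/
structure Data (L : Layout) (n : ℕ) where
  cont : Fin n → Fin L.numCont → ℝ
  level : Fin n → (k : Fin L.numFactors) → L.Level k

/-- The model matrix `[1, X₀, X₁, …, X_l]`, where `X₁, …, X_l` are the zero-one dummy codings
of the factors. -/
def Data.X {L : Layout} {n : ℕ} (D : Data L n) : Matrix (Fin n) L.Param ℝ :=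
  Matrix.of fun i => Sum.elim (fun _ => 1)
    (Sum.elim (D.cont i) (fun q => if D.level i q.1 = q.2.succ then 1 else 0))

/-! ### Feasible models -/

/-- A feasible model: the set of continuous regressors that are kept and a partition of the
levels of each factor. -/
@[ext]
structure Model (L : Layout) where
  cont : Finset (Fin L.numCont)
  part : (k : Fin L.numFactors) → Finpartition (Finset.univ : Finset (L.Level k))

namespace Model

variable {L : Layout} (M : Model L)

/-- The linear space of parameters of the model: the coefficients of the deleted continuous
regressors vanish, and levels in the same cluster have equal coefficients. -/
def space : Submodule ℝ (L.Param → ℝ) where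
  carrier := {β | (∀ j, j ∉ M.cont → L.contVec j ⬝ᵥ β = 0) ∧
    ∀ k, ∀ C ∈ (M.part k).parts, ∀ i ∈ C, ∀ j ∈ C, L.levelVec k i ⬝ᵥ β = L.levelVec k j ⬝ᵥ β}
  add_mem' := by
    rintro a b ⟨ha, ha'⟩ ⟨hb, hb'⟩
    refine ⟨fun j hj => ?_, fun k C hC i hi j hj => ?_⟩
    · rw [dotProduct_add, ha j hj, hb j hj, add_zero]
    · rw [dotProduct_add, dotProduct_add, ha' k C hC i hi j hj, hb' k C hC i hi j hj]
  zero_mem' := by simp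
  smul_mem' := by
    rintro c a ⟨ha, ha'⟩
    refine ⟨fun j hj => ?_, fun k C hC i hi j hj => ?_⟩
    · rw [dotProduct_smul, ha j hj, smul_zero]
    · rw [dotProduct_smul, dotProduct_smul, ha' k C hC i hi j hj]

/-- The size of the model: the dimension of its parameter space. -/
def size : ℕ := Module.finrank ℝ M.space

/-- The full model, without constraints. -/
def full (L : Layout) : Model L where
  cont := Finset.univ
  part _ := ⊥

/-- Index set of the free parameters: the intercept, the kept continuous regressors, and the
clusters that do not contain the reference level. -/
abbrev Free : Type :=
  Unit ⊕ ({j // j ∈ M.cont} ⊕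
    (Σ k : Fin L.numFactors, {C : Finset (L.Level k) // C ∈ (M.part k).parts ∧ 0 ∉ C}))

/-- The matrix `A¹_M`, which recovers the parameter vector from the free parameters. -/
def A1 : Matrix L.Param M.Free ℝ :=
  Matrix.of fun a f => match a, f with
    | Sum.inl _, Sum.inl _ => 1
    | Sum.inr (Sum.inl j), Sum.inr (Sum.inl j') => if j = j' then 1 else 0
    | Sum.inr (Sum.inr q), Sum.inr (Sum.inr C) =>
        if ∃ i ∈ C.2.1, (⟨C.1, i⟩ : Σ k, L.Level k) = ⟨q.1, q.2.succ⟩ then 1 else 0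
    | _, _ => 0

/-- `Σ_M = A¹ (A¹ᵀ Σ A¹)⁻¹ A¹ᵀ`. -/
def limitCov (S : Matrix L.Param L.Param ℝ) : Matrix L.Param L.Param ℝ :=
  M.A1 * (M.A1ᵀ * S * M.A1)⁻¹ * M.A1ᵀ

/-- `M` is a true model of minimal size for the parameter vector `β`. -/
def IsMinimalTrue (β : L.Param → ℝ) : Prop :=
  β ∈ M.space ∧ ∀ M' : Model L, β ∈ M'.space → M.size ≤ M'.size

end Model

section Estimation

variable {L : Layout} {n : ℕ} (D : Data L n) (y : Fin n → ℝ)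

/-- The model matrix `Z₁ = X A¹` of the unconstrained parametrization. -/
def Z1 (M : Model L) : Matrix (Fin n) M.Free ℝ := D.X * M.A1

/-- The least squares estimator constrained to the model `M`. -/
def betaHat (M : Model L) : L.Param → ℝ :=
  M.A1 *ᵥ (((Z1 D M)ᵀ * Z1 D M)⁻¹ *ᵥ ((Z1 D M)ᵀ *ᵥ y))

/-- The projection matrix `H_M = Z₁ (Z₁ᵀ Z₁)⁻¹ Z₁ᵀ`. -/
def hat (M : Model L) : Matrix (Fin n) (Fin n) ℝ :=
  Z1 D M * ((Z1 D M)ᵀ * Z1 D M)⁻¹ * (Z1 D M)ᵀ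

/-- Residual sum of squares of a parameter vector. -/
def rssOf (b : L.Param → ℝ) : ℝ := ∑ i, (y i - (D.X *ᵥ b) i) ^ 2

/-- Residual sum of squares of a model. -/
def rss (M : Model L) : ℝ := rssOf D y (betaHat D y M)

/-- Generalized information criterion with penalty `r`. -/
def gic (r : ℝ) (M : Model L) : ℝ := n * Real.log (rss D y M) + r * M.size

/-- The least squares estimator without constraints. -/
def olsFull : L.Param → ℝ := (D.Xᵀ * D.X)⁻¹ *ᵥ (D.Xᵀ *ᵥ y)

/-- The unbiased variance estimator of the full model. -/
def sigmaHatSq : ℝ := rssOf D y (olsFull D y) / ((n : ℝ) - L.numParams)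

/-- Squared t-statistic of the constraint `a ⬝ β = 0`. -/
def tSq (a : L.Param → ℝ) : ℝ :=
  (a ⬝ᵥ olsFull D y) ^ 2 / (sigmaHatSq D y * (a ⬝ᵥ ((D.Xᵀ * D.X)⁻¹ *ᵥ a)))

/-- Dissimilarity of two levels of factor `k`: the squared t-statistic of the equality of their
coefficients (the coefficient of the reference level being `0`). -/
def dissim (k : Fin L.numFactors) (i j : L.Level k) : ℝ :=
  tSq D y (L.levelVec k i - L.levelVec k j)

/-- `Δ_M = βᵀ Xᵀ (I - H_M) X β`. -/
def loss (β : L.Param → ℝ) (M : Model L) : ℝ :=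
  (D.X *ᵥ β) ⬝ᵥ ((1 - hat D M) *ᵥ (D.X *ᵥ β))

/-- `Δ`, the minimum of `Δ_M` over the models `M` with exactly one constraint, which is false
(with value `∞` if there is no such model). -/
def minLoss (β : L.Param → ℝ) (T : Model L) : ℝ≥0∞ :=
  ⨅ M ∈ {M : Model L | M.size + 1 = (Model.full L).size ∧ ¬ T.space ≤ M.space},
    ENNReal.ofReal (loss D β M)

end Estimation

/-! ### The procedure -/

/-- A run of agglomerative clustering of `m + 1` points with dissimilarity `d`. In each of the
`m` steps two clusters at minimal distance are merged (ties are broken arbitrarily). The distance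
from the merged cluster to any other cluster is a convex combination of the minimum and
the maximum of the distances from the two merged clusters; the weight `b ∈ [0, 1]` may be the
same throughout or vary from one update to another. -/
structure Clustering {m : ℕ} (d : Fin (m + 1) → Fin (m + 1) → ℝ) where
  /-- The partition before step `s`. -/
  part : ℕ → Finpartition (Finset.univ : Finset (Fin (m + 1)))
  /-- The distances between clusters before step `s`. -/
  dist : ℕ → Finset (Fin (m + 1)) → Finset (Fin (m + 1)) → ℝ
  /-- The two clusters merged in step `s`. -/
  left : ℕ → Finset (Fin (m + 1))
  right : ℕ → Finset (Fin (m + 1))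
  part_zero : part 0 = ⊥
  dist_zero : ∀ i j, dist 0 {i} {j} = d i j
  left_mem : ∀ s < m, left s ∈ (part s).parts
  right_mem : ∀ s < m, right s ∈ (part s).parts
  left_ne_right : ∀ s < m, left s ≠ right s
  minimal : ∀ s < m, ∀ C ∈ (part s).parts, ∀ E ∈ (part s).parts, C ≠ E →
    dist s (left s) (right s) ≤ dist s C E
  merge : ∀ s < m, (part (s + 1)).parts =
    insert (left s ∪ right s) (((part s).parts.erase (left s)).erase (right s))
  linkage : ∀ s < m, ∀ C ∈ (part s).parts, C ≠ left s → C ≠ right s →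
    ∃ b ∈ Set.Icc (0 : ℝ) 1, dist (s + 1) (left s ∪ right s) C =
      b * min (dist s (left s) C) (dist s (right s) C) +
        (1 - b) * max (dist s (left s) C) (dist s (right s) C)
  linkage_symm : ∀ s < m, ∀ C ∈ (part s).parts, C ≠ left s → C ≠ right s →
    dist (s + 1) C (left s ∪ right s) = dist (s + 1) (left s ∪ right s) C
  dist_other : ∀ s < m, ∀ C ∈ (part s).parts, ∀ E ∈ (part s).parts,
    C ≠ left s → C ≠ right s → E ≠ left s → E ≠ right s → dist (s + 1) C E = dist s C E

/-- The cutting height of step `s`. -/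
def Clustering.height {m : ℕ} {d : Fin (m + 1) → Fin (m + 1) → ℝ} (c : Clustering d)
    (s : ℕ) : ℝ :=
  c.dist s (c.left s) (c.right s)

section Procedure

variable {L : Layout} {n : ℕ} (D : Data L n) (y : Fin n → ℝ)

/-- The height of an elementary constraint: the squared t-statistic for a continuous regressor,
the cutting height for a merging step of a factor. -/
def stepHeight (c : ∀ k, Clustering (dissim D y k)) : L.Step → ℝ
  | Sum.inl j => tSq D y (L.contVec j)
  | Sum.inr q => (c q.1).height q.2

/-- The elementary constraint of a step, as a row of the constraint matrix. For a merging step it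
equates the coefficients of the minimal levels of the two merged clusters (for a nonempty finite
set `C` of levels, `C.inf id` is its minimum). -/
def stepVec (c : ∀ k, Clustering (dissim D y k)) : L.Step → L.Param → ℝ
  | Sum.inl j => L.contVec j
  | Sum.inr q => L.levelVec q.1 (((c q.1).left q.2).inf id) -
      L.levelVec q.1 (((c q.1).right q.2).inf id)

/-- `M` is an output of the procedure for the data `D`, `y` and the penalty `r`: each factor is
clustered; the elementary constraints are sorted by increasing height; `path m` is the
model given by the first `m` constraints; `M` minimizes the criterion along the path. -/
def IsOutput (r : ℝ) (M : Model L) : Prop :=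
  ∃ (c : ∀ k, Clustering (dissim D y k)) (e : Fin (Fintype.card L.Step) ≃ L.Step)
    (path : Fin (Fintype.card L.Step + 1) → Model L),
    Monotone (fun i => stepHeight D y c (e i)) ∧
    (∀ m, ∀ b : L.Param → ℝ, b ∈ (path m).space ↔
      ∀ i : Fin (Fintype.card L.Step), (i : ℕ) < (m : ℕ) → stepVec D y c (e i) ⬝ᵥ b = 0) ∧
    ∃ m, M = path m ∧ ∀ m', gic D y r (path m) ≤ gic D y r (path m')

end Procedure

/-! ### Asymptotic setting -/

/-- `f ≺ g`, that is `f = o(g)`, for sequences in `[0, ∞]`. -/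
def Prec (f g : ℕ → ℝ≥0∞) : Prop := Tendsto (fun n => f n / g n) atTop (𝓝 0)

/-- The assumptions. For the sample size `n` we have the layout `L n`, the regressors `D n`, the
parameter vector `β n`, the minimal true model `T n`, Gaussian errors `ε n` with variance `σ ^ 2`,
the penalty `r n`, and the selected model `That n`. -/
structure Setting {Ω : ℕ → Type*} [∀ n, MeasurableSpace (Ω n)] (P : ∀ n, Measure (Ω n))
    (L : ℕ → Layout) (D : ∀ n, Data (L n) n) (β : ∀ n, (L n).Param → ℝ) (T : ∀ n, Model (L n))
    (σ : ℝ) (ε : ∀ n, Ω n → Fin n → ℝ) (r : ℕ → ℝ) (That : ∀ n, Ω n → Model (L n)) : Prop where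
  sigma_pos : 0 < σ
  /-- The errors are i.i.d. `N(0, σ²)`. -/
  errors : ∀ n, HasLaw (ε n) (Measure.pi fun _ => gaussianReal 0 (σ ^ 2).toNNReal) (P n)
  /-- The model matrix is of full rank. -/
  full_rank : ∀ᶠ n in atTop, (D n).X.rank = (L n).numParams
  true_model : ∀ n, (T n).IsMinimalTrue (β n)
  /-- The size of the true model does not grow; this is all that is needed from
  a true model that does not depend on the sample size. -/
  true_size : ∃ K : ℕ, ∀ n, (T n).size ≤ K
  /-- `p_n ≺ r_n` (in particular `r_n > 0` eventually). -/
  params_prec : Prec (fun n => ((L n).numParams : ℝ≥0∞)) (fun n => ENNReal.ofReal (r n))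
  /-- `r_n ≺ min (n, Δ)`. -/
  penalty_prec : Prec (fun n => ENNReal.ofReal (r n))
    (fun n => min (n : ℝ≥0∞) (minLoss (D n) (β n) (T n)))
  /-- The selected model is an output of the procedure for the response `y = X β + ε`. -/
  selected : ∀ n ω, IsOutput (D n) ((D n).X *ᵥ β n + ε n ω) (r n) (That n ω)
  measurable_selected : ∀ n M, MeasurableSet {ω | That n ω = M}

end DMR

end

/-!
Cauchy-Schwarz in the metric of `(Xᵀ X)⁻¹` shows that the projection of the errors on the column
space of `X`, once its squared length is at most a sixteenth of `δ = min (n, Δ)`, leaves a gap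
between the squared t-statistics of the elementary constraints: up to the factor `σ̂⁻²` they are at
most `δ / 16` for the constraints that hold for `β` and at least `9 δ / 16` for those that do not.
Minimality of the merged distance preserves such a gap in every linkage between the minimum and the
maximum, so that all true merges precede all false ones and the true model lies on the path. On the
path the criterion then decides: a false model costs `n log (1 + const · δ / n)`, which dominates
`r |T|`, while every superfluous parameter costs `r` and gains at most the squared length of the
projection, divided by a multiple of the error variance. This squared length has mean `σ² p = o(r)`,
so Markov's inequality and the weak law for the squared length of the errors finish the proof of
consistency, for errors of any centered law of finite variance.

Outside an event of vanishing probability the scaled error in the selected model is the one in the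
true model, a linear image of the error vector, which is exactly normal with a covariance that
converges.
-/

namespace DMR

/-! ### Agglomerative clustering of well separated points -/

namespace Clustering

variable {m : ℕ} {d : Fin (m + 1) → Fin (m + 1) → ℝ} (c : Clustering d)

theorem inf_id_mem {C : Finset (Fin (m + 1))} (hC : C.Nonempty) : C.inf id ∈ C := by
  obtain ⟨i, hi, h⟩ := C.exists_mem_eq_inf hC id
  exact h ▸ hi

theorem nonempty_of_mem_part {s : ℕ} {C : Finset (Fin (m + 1))} (hC : C ∈ (c.part s).parts) :
    C.Nonempty :=
  (c.part s).nonempty_of_mem_parts hC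

theorem inf_left_mem {s : ℕ} (hs : s < m) : (c.left s).inf id ∈ c.left s :=
  inf_id_mem (c.nonempty_of_mem_part (c.left_mem s hs))

theorem inf_right_mem {s : ℕ} (hs : s < m) : (c.right s).inf id ∈ c.right s :=
  inf_id_mem (c.nonempty_of_mem_part (c.right_mem s hs))

theorem exists_singleton_of_mem_part_zero {C : Finset (Fin (m + 1))}
    (hC : C ∈ (c.part 0).parts) : ∃ i, C = {i} := by
  rw [c.part_zero, Finpartition.mem_bot_iff] at hC
  obtain ⟨i, -, hi⟩ := hC
  exact ⟨i, hi.symm⟩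

theorem mem_part_succ {s : ℕ} (hs : s < m) {C : Finset (Fin (m + 1))} :
    C ∈ (c.part (s + 1)).parts ↔ C = c.left s ∪ c.right s ∨
      (C ∈ (c.part s).parts ∧ C ≠ c.left s ∧ C ≠ c.right s) := by
  rw [c.merge s hs]
  simp only [Finset.mem_insert, Finset.mem_erase]
  tauto

theorem left_union_right_notMem {s : ℕ} (hs : s < m) :
    c.left s ∪ c.right s ∉ ((c.part s).parts.erase (c.left s)).erase (c.right s) := by
  simp only [Finset.mem_erase, not_and]
  intro _ hne hmem
  exact hne ((c.part s).eq_of_mem_parts hmem (c.left_mem s hs)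
    (Finset.mem_union_left _ (c.inf_left_mem hs)) (c.inf_left_mem hs))

theorem card_part_parts : ∀ s ≤ m, (c.part s).parts.card = m + 1 - s := by
  intro s
  induction s with
  | zero => intro _; simp [c.part_zero]
  | succ s ih =>
    intro hs
    have hright : c.right s ∈ (c.part s).parts.erase (c.left s) :=
      Finset.mem_erase.2 ⟨(c.left_ne_right s hs).symm, c.right_mem s hs⟩
    rw [c.merge s hs, Finset.card_insert_of_notMem (c.left_union_right_notMem hs),
      Finset.card_erase_of_mem hright, Finset.card_erase_of_mem (c.left_mem s hs),
      ih (Nat.le_of_lt hs)]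
    lia

theorem part_last_parts : (c.part m).parts = {Finset.univ} := by
  obtain ⟨C, hC⟩ := Finset.card_eq_one.1 ((c.card_part_parts m le_rfl).trans (by lia))
  have hsup := (c.part m).sup_parts
  rw [hC, Finset.sup_singleton, id_eq] at hsup
  rw [hC, hsup]

theorem dist_left_union_right_mem {s : ℕ} (hs : s < m) {I : Set ℝ} (hI : I.OrdConnected)
    {C : Finset (Fin (m + 1))} (hC : C ∈ (c.part s).parts) (hl : C ≠ c.left s)
    (hr : C ≠ c.right s) (hlI : c.dist s (c.left s) C ∈ I) (hrI : c.dist s (c.right s) C ∈ I) :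
    c.dist (s + 1) (c.left s ∪ c.right s) C ∈ I := by
  obtain ⟨b, ⟨hb0, hb1⟩, hb⟩ := c.linkage s hs C hC hl hr
  rw [hb]
  exact hI.convex (min_rec' (· ∈ I) hlI hrI) (max_rec' (· ∈ I) hlI hrI) hb0
    (sub_nonneg.2 hb1) (add_sub_cancel b 1)

variable {α γ : Type*} {f : Fin (m + 1) → α} {g : Fin (m + 1) → γ} {lo hi : ℝ}

/-- Separation of two clusters at distance `x` by the fibres of `f`: either both clusters lie in one
fibre and `x` is at most `lo`, or no fibre meets both and `x` is at least `hi`. -/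
def ClustersSeparated (f : Fin (m + 1) → α) (lo hi x : ℝ) (C E : Finset (Fin (m + 1))) : Prop :=
  (x ≤ lo ∧ ∀ i ∈ C, ∀ j ∈ E, f i = f j) ∨ (hi ≤ x ∧ ∀ i ∈ C, ∀ j ∈ E, f i ≠ f j)

theorem ClustersSeparated.symm {x : ℝ} {C E : Finset (Fin (m + 1))}
    (h : ClustersSeparated f lo hi x C E) : ClustersSeparated f lo hi x E C :=
  h.imp (And.imp_right fun h i hi j hj => (h j hj i hi).symm)
    (And.imp_right fun h i hi j hj => (h j hj i hi).symm)

/-- A dissimilarity separates the fibres of `f`: it is at most `lo` within fibres and at least `hi`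
between fibres. -/
def Separates (d : Fin (m + 1) → Fin (m + 1) → ℝ) (f : Fin (m + 1) → α) (lo hi : ℝ) : Prop :=
  ∀ i j, (f i = f j → d i j ≤ lo) ∧ (f i ≠ f j → hi ≤ d i j)

theorem clustersSeparated_zero (hd : Separates d f lo hi) {C E : Finset (Fin (m + 1))}
    (hC : C ∈ (c.part 0).parts) (hE : E ∈ (c.part 0).parts) :
    ClustersSeparated f lo hi (c.dist 0 C E) C E := by
  obtain ⟨i, rfl⟩ := c.exists_singleton_of_mem_part_zero hC
  obtain ⟨j, rfl⟩ := c.exists_singleton_of_mem_part_zero hE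
  simp only [ClustersSeparated, c.dist_zero, Finset.mem_singleton, forall_eq]
  exact (em (f i = f j)).imp (fun h => ⟨(hd i j).1 h, h⟩) (fun h => ⟨(hd i j).2 h, h⟩)

theorem clustersSeparated_left_union_right {s : ℕ} (hs : s < m) (hlohi : lo < hi)
    (h : ∀ C ∈ (c.part s).parts, ∀ E ∈ (c.part s).parts, C ≠ E →
      ClustersSeparated f lo hi (c.dist s C E) C E)
    {C : Finset (Fin (m + 1))} (hC : C ∈ (c.part s).parts) (hl : C ≠ c.left s)
    (hr : C ≠ c.right s) :
    ClustersSeparated f lo hi (c.dist (s + 1) (c.left s ∪ c.right s) C)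
      (c.left s ∪ c.right s) C := by
  have hL := c.left_mem s hs
  have hR := c.right_mem s hs
  obtain ⟨x, hx⟩ := c.nonempty_of_mem_part hL
  obtain ⟨y, hy⟩ := c.nonempty_of_mem_part hR
  obtain ⟨z, hz⟩ := c.nonempty_of_mem_part hC
  -- If one merged cluster is close to `C`, then by minimality the merged clusters are close too.
  have merged_close : c.dist s (c.left s) C ≤ lo ∨ c.dist s (c.right s) C ≤ lo → f x = f y := by
    intro hclose
    have hheight : c.dist s (c.left s) (c.right s) ≤ lo := hclose.elim
      (c.minimal s hs _ hL _ hC hl.symm).trans (c.minimal s hs _ hR _ hC hr.symm).trans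
    rcases h _ hL _ hR (c.left_ne_right s hs) with hnear | hfar
    · exact hnear.2 x hx y hy
    · exact absurd (hfar.1.trans hheight) (not_le.2 hlohi)
  rcases h _ hL _ hC hl.symm with ⟨hdl, hfl⟩ | ⟨hdl, hfl⟩ <;>
    rcases h _ hR _ hC hr.symm with ⟨hdr, hfr⟩ | ⟨hdr, hfr⟩
  · refine Or.inl ⟨c.dist_left_union_right_mem hs Set.ordConnected_Iic hC hl hr hdl hdr, ?_⟩
    exact fun i hi => (Finset.mem_union.1 hi).elim (hfl i) (hfr i)
  · exact absurd ((merged_close (Or.inl hdl)).symm.trans (hfl x hx z hz)) (hfr y hy z hz)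
  · exact absurd ((merged_close (Or.inr hdr)).trans (hfr y hy z hz)) (hfl x hx z hz)
  · refine Or.inr ⟨c.dist_left_union_right_mem hs Set.ordConnected_Ici hC hl hr hdl hdr, ?_⟩
    exact fun i hi => (Finset.mem_union.1 hi).elim (hfl i) (hfr i)

theorem clustersSeparated_of_separates (hlohi : lo < hi) (hd : Separates d f lo hi) :
    ∀ s ≤ m, ∀ C ∈ (c.part s).parts, ∀ E ∈ (c.part s).parts, C ≠ E →
      ClustersSeparated f lo hi (c.dist s C E) C E := by
  intro s
  induction s with
  | zero => exact fun _ C hC E hE _ => c.clustersSeparated_zero hd hC hE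
  | succ s ih =>
    intro hs C hC E hE hCE
    have hmerged := fun A => c.clustersSeparated_left_union_right (C := A) hs hlohi
      (ih (Nat.le_of_lt hs))
    rcases (c.mem_part_succ hs).1 hC with rfl | ⟨hC, hCl, hCr⟩ <;>
      rcases (c.mem_part_succ hs).1 hE with rfl | ⟨hE, hEl, hEr⟩
    · exact absurd rfl hCE
    · exact hmerged E hE hEl hEr
    · rw [c.linkage_symm s hs C hC hCl hCr]
      exact (hmerged C hC hCl hCr).symm
    · rw [c.dist_other s hs C hC E hE hCl hCr hEl hEr]
      exact ih (Nat.le_of_lt hs) C hC E hE hCE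

theorem clustersSeparated_left_right (hlohi : lo < hi) (hd : Separates d f lo hi) {s : ℕ}
    (hs : s < m) : ClustersSeparated f lo hi (c.height s) (c.left s) (c.right s) :=
  c.clustersSeparated_of_separates hlohi hd s hs.le _ (c.left_mem s hs) _ (c.right_mem s hs)
    (c.left_ne_right s hs)

theorem height_le_or_le_height (hlohi : lo < hi) (hd : Separates d f lo hi) {s : ℕ}
    (hs : s < m) :
    (c.height s ≤ lo ∧ f ((c.left s).inf id) = f ((c.right s).inf id)) ∨
      (hi ≤ c.height s ∧ f ((c.left s).inf id) ≠ f ((c.right s).inf id)) :=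
  (c.clustersSeparated_left_right hlohi hd hs).imp
    (And.imp_right fun h => h _ (c.inf_left_mem hs) _ (c.inf_right_mem hs))
    (And.imp_right fun h => h _ (c.inf_left_mem hs) _ (c.inf_right_mem hs))

theorem eq_on_part_of_eq_at_low_steps (hlohi : lo < hi) (hd : Separates d f lo hi)
    (hg : ∀ s < m, c.height s ≤ lo → g ((c.left s).inf id) = g ((c.right s).inf id)) :
    ∀ s ≤ m, ∀ C ∈ (c.part s).parts, ∀ i ∈ C, ∀ j ∈ C, f i = f j → g i = g j := by
  intro s
  induction s with
  | zero =>
    intro _ C hC i hi j hj _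
    obtain ⟨x, rfl⟩ := c.exists_singleton_of_mem_part_zero hC
    rw [Finset.mem_singleton.1 hi, Finset.mem_singleton.1 hj]
  | succ s ih =>
    intro hs C hC
    have hl := c.inf_left_mem hs
    have hr := c.inf_right_mem hs
    have ihL := ih (Nat.le_of_lt hs) _ (c.left_mem s hs)
    have ihR := ih (Nat.le_of_lt hs) _ (c.right_mem s hs)
    have cross : ∀ i ∈ c.left s, ∀ j ∈ c.right s, f i = f j → g i = g j := by
      intro i hi j hj hij
      rcases c.clustersSeparated_left_right hlohi hd hs with ⟨hlow, hf⟩ | ⟨-, hf⟩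
      · calc g i = g ((c.left s).inf id) := ihL i hi _ hl (hij.trans (hf _ hl j hj).symm)
          _ = g ((c.right s).inf id) := hg s hs hlow
          _ = g j := ihR _ hr j hj ((hf i hi _ hr).symm.trans hij)
      · exact absurd hij (hf i hi j hj)
    rcases (c.mem_part_succ hs).1 hC with rfl | ⟨hC, -, -⟩
    · intro i hi j hj hij
      rcases Finset.mem_union.1 hi with hi | hi <;> rcases Finset.mem_union.1 hj with hj | hj
      · exact ihL i hi j hj hij
      · exact cross i hi j hj hij
      · exact (cross j hj i hi hij.symm).symm
      · exact ihR i hi j hj hij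
    · exact ih (Nat.le_of_lt hs) C hC

theorem eq_of_eq_at_low_steps (hlohi : lo < hi) (hd : Separates d f lo hi)
    (hg : ∀ s < m, c.height s ≤ lo → g ((c.left s).inf id) = g ((c.right s).inf id))
    {i j : Fin (m + 1)} (hij : f i = f j) : g i = g j :=
  c.eq_on_part_of_eq_at_low_steps hlohi hd hg m le_rfl Finset.univ (by simp [c.part_last_parts])
    i (Finset.mem_univ i) j (Finset.mem_univ j) hij

end Clustering
/-! ### Feasible models -/

theorem finpartition_ext_part {α : Type*} [DecidableEq α] {s : Finset α} {P Q : Finpartition s}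
    (h : ∀ i ∈ s, P.part i = Q.part i) : P = Q := by
  refine Finpartition.ext (Finset.ext fun C => ⟨fun hC => ?_, fun hC => ?_⟩)
  · obtain ⟨i, hi⟩ := P.nonempty_of_mem_parts hC
    have his : i ∈ s := P.le hC hi
    rw [← P.part_eq_of_mem hC hi, h i his]
    exact Q.part_mem.2 his
  · obtain ⟨i, hi⟩ := Q.nonempty_of_mem_parts hC
    have his : i ∈ s := Q.le hC hi
    rw [← Q.part_eq_of_mem hC hi, ← h i his]
    exact P.part_mem.2 his

theorem finrank_add_one_of_mem_iff_dotProduct_eq_zero {ι K : Type*} [Fintype ι] [Field K]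
    {a : ι → K} (ha : a ≠ 0) {V : Submodule K (ι → K)} (hV : ∀ b, b ∈ V ↔ a ⬝ᵥ b = 0) :
    Module.finrank K V + 1 = Fintype.card ι := by
  have hker : V = LinearMap.ker (dotProductBilin K K a) := Submodule.ext hV
  have hne : dotProductBilin K K a ≠ 0 := fun h =>
    ha (dotProduct_eq_zero_iff.1 fun b => LinearMap.congr_fun h b)
  rw [hker, Module.Dual.finrank_ker_add_one_of_ne_zero hne, Module.finrank_fintype_fun_eq_card]

namespace Layout

variable (L : Layout)

theorem contVec_dotProduct (j : Fin L.numCont) (b : L.Param → ℝ) :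
    L.contVec j ⬝ᵥ b = b (Sum.inr (Sum.inl j)) := by
  simp [contVec]

@[simp]
theorem levelVec_zero (k : Fin L.numFactors) : L.levelVec k 0 = 0 := rfl

theorem levelVec_succ_dotProduct (k : Fin L.numFactors) (j : Fin (L.extraLevels k))
    (b : L.Param → ℝ) : L.levelVec k j.succ ⬝ᵥ b = b (Sum.inr (Sum.inr ⟨k, j⟩)) := by
  simp [levelVec]

theorem param_ext {b b' : L.Param → ℝ} (h0 : b (Sum.inl ()) = b' (Sum.inl ()))
    (hc : ∀ j, L.contVec j ⬝ᵥ b = L.contVec j ⬝ᵥ b')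
    (hl : ∀ k i, L.levelVec k i ⬝ᵥ b = L.levelVec k i ⬝ᵥ b') : b = b' := by
  funext a
  rcases a with _ | j | ⟨k, j⟩
  · exact h0
  · simpa only [contVec_dotProduct] using hc j
  · simpa only [levelVec_succ_dotProduct] using hl k j.succ

variable {L}

/-- The constraint vectors that feasible models are made of: a continuous regressor is deleted, or
two levels of a factor have equal coefficients. -/
def IsElementary (a : L.Param → ℝ) : Prop :=
  (∃ j, a = L.contVec j) ∨ ∃ k i j, a = L.levelVec k i - L.levelVec k j

theorem isElementary_contVec (j : Fin L.numCont) : IsElementary (L.contVec j) :=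
  Or.inl ⟨j, rfl⟩

theorem isElementary_levelVec_sub (k : Fin L.numFactors) (i j : L.Level k) :
    IsElementary (L.levelVec k i - L.levelVec k j) :=
  Or.inr ⟨k, i, j, rfl⟩

end Layout

namespace Model

open Layout

variable {L : Layout}

instance : Finite (Model L) :=
  Finite.of_injective (fun M : Model L => (M.cont, M.part)) fun M M' h => by
    simp only [Prod.mk.injEq] at h
    exact Model.ext h.1 h.2

section A1

variable (M : Model L) (u : M.Free → ℝ)

theorem A1_mulVec_intercept : (M.A1 *ᵥ u) (Sum.inl ()) = u (Sum.inl ()) := by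
  simp [A1, Matrix.mulVec, dotProduct]

variable {M}

theorem contVec_dotProduct_A1_mulVec {j : Fin L.numCont} (hj : j ∈ M.cont) :
    L.contVec j ⬝ᵥ M.A1 *ᵥ u = u (Sum.inr (Sum.inl ⟨j, hj⟩)) := by
  classical
  have hrow : M.A1 (Sum.inr (Sum.inl j)) = Pi.single (Sum.inr (Sum.inl ⟨j, hj⟩)) 1 := by
    funext f
    rcases f with _ | j' | C <;> simp [A1, Pi.single_apply, Subtype.ext_iff, eq_comm]
  rw [contVec_dotProduct, Matrix.mulVec, hrow, single_one_dotProduct]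

theorem contVec_dotProduct_A1_mulVec_of_notMem {j : Fin L.numCont} (hj : j ∉ M.cont) :
    L.contVec j ⬝ᵥ M.A1 *ᵥ u = 0 := by
  have hrow : M.A1 (Sum.inr (Sum.inl j)) = 0 := by
    funext f
    rcases f with _ | ⟨j', hj'⟩ | C
    · rfl
    · refine if_neg ?_
      rintro rfl
      exact hj hj'
    · rfl
  rw [contVec_dotProduct, Matrix.mulVec, hrow, zero_dotProduct]

theorem levelVec_dotProduct_A1_mulVec {k : Fin L.numFactors}
    {C : {C : Finset (L.Level k) // C ∈ (M.part k).parts ∧ 0 ∉ C}} {i : L.Level k}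
    (hi : i ∈ C.1) : L.levelVec k i ⬝ᵥ M.A1 *ᵥ u = u (Sum.inr (Sum.inr ⟨k, C⟩)) := by
  classical
  induction i using Fin.cases with
  | zero => exact absurd hi C.2.2
  | succ x =>
    have hrow : M.A1 (Sum.inr (Sum.inr ⟨k, x⟩)) = Pi.single (Sum.inr (Sum.inr ⟨k, C⟩)) 1 := by
      funext f
      rcases f with _ | j | ⟨k', C'⟩
      · simp [A1]
      · simp [A1]
      · rw [Pi.single_apply]
        refine if_congr ⟨?_, ?_⟩ rfl rfl
        · rintro ⟨i', hi', h⟩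
          cases h
          exact congrArg _ (congrArg _ (congrArg _ (Subtype.ext
            ((M.part k).eq_of_mem_parts C'.2.1 C.2.1 hi' hi))))
        · intro h
          cases h
          exact ⟨x.succ, hi, rfl⟩
    rw [levelVec_succ_dotProduct, Matrix.mulVec, hrow, single_one_dotProduct]

theorem levelVec_dotProduct_A1_mulVec_of_zero_mem {k : Fin L.numFactors}
    {C : Finset (L.Level k)} (hC : C ∈ (M.part k).parts) (h0 : 0 ∈ C) {i : L.Level k}
    (hi : i ∈ C) : L.levelVec k i ⬝ᵥ M.A1 *ᵥ u = 0 := by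
  induction i using Fin.cases with
  | zero => rw [levelVec_zero, zero_dotProduct]
  | succ x =>
    have hrow : M.A1 (Sum.inr (Sum.inr ⟨k, x⟩)) = 0 := by
      funext f
      rcases f with _ | j | ⟨k', C'⟩
      · rfl
      · rfl
      · refine if_neg ?_
        rintro ⟨i', hi', h⟩
        cases h
        exact C'.2.2 ((M.part k).eq_of_mem_parts hC C'.2.1 hi hi' ▸ h0)
    rw [levelVec_succ_dotProduct, Matrix.mulVec, hrow, zero_dotProduct]

variable (M)

theorem A1_mulVec_mem_space : M.A1 *ᵥ u ∈ M.space := by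
  refine ⟨fun j hj => contVec_dotProduct_A1_mulVec_of_notMem u hj, fun k C hC i hi j hj => ?_⟩
  by_cases h0 : 0 ∈ C
  · rw [levelVec_dotProduct_A1_mulVec_of_zero_mem u hC h0 hi,
      levelVec_dotProduct_A1_mulVec_of_zero_mem u hC h0 hj]
  · rw [levelVec_dotProduct_A1_mulVec (C := ⟨C, hC, h0⟩) u hi,
      levelVec_dotProduct_A1_mulVec (C := ⟨C, hC, h0⟩) u hj]

theorem A1_mulVec_injective : Function.Injective M.A1.mulVec := by
  intro u u' h
  funext a
  rcases a with _ | ⟨j, hj⟩ | ⟨k, C⟩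
  · rw [← A1_mulVec_intercept M u, h, A1_mulVec_intercept]
  · rw [← contVec_dotProduct_A1_mulVec u hj, h, contVec_dotProduct_A1_mulVec]
  · obtain ⟨i, hi⟩ := (M.part k).nonempty_of_mem_parts C.2.1
    rw [← levelVec_dotProduct_A1_mulVec u hi, h, levelVec_dotProduct_A1_mulVec u' hi]

theorem exists_A1_mulVec_eq {b : L.Param → ℝ} (hb : b ∈ M.space) : ∃ u, M.A1 *ᵥ u = b := by
  let u : M.Free → ℝ := Sum.elim (fun _ => b (Sum.inl ()))
    (Sum.elim (fun j => L.contVec j ⬝ᵥ b) (fun C => L.levelVec C.1 (C.2.1.inf id) ⬝ᵥ b))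
  refine ⟨u, L.param_ext (A1_mulVec_intercept M u) (fun j => ?_) (fun k i => ?_)⟩
  · by_cases hj : j ∈ M.cont
    · exact contVec_dotProduct_A1_mulVec u hj
    · rw [contVec_dotProduct_A1_mulVec_of_notMem u hj, hb.1 j hj]
  · obtain ⟨C, hC, hi⟩ := (M.part k).exists_mem (Finset.mem_univ i)
    by_cases h0 : 0 ∈ C
    · rw [levelVec_dotProduct_A1_mulVec_of_zero_mem u hC h0 hi, hb.2 k C hC i hi 0 h0,
        levelVec_zero, zero_dotProduct]
    · rw [levelVec_dotProduct_A1_mulVec (C := ⟨C, hC, h0⟩) u hi]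
      exact hb.2 k C hC _ (Clustering.inf_id_mem ⟨i, hi⟩) i hi

end A1

section Space

variable (M : Model L)

theorem mem_cont_iff {j : Fin L.numCont} : j ∈ M.cont ↔ ∃ b ∈ M.space, L.contVec j ⬝ᵥ b ≠ 0 := by
  refine ⟨fun hj => ⟨M.A1 *ᵥ 1, M.A1_mulVec_mem_space 1, ?_⟩, ?_⟩
  · rw [contVec_dotProduct_A1_mulVec 1 hj]
    exact one_ne_zero
  · rintro ⟨b, hb, hne⟩
    by_contra hj
    exact hne (hb.1 j hj)

theorem exists_mem_space_levelVec_ne {k : Fin L.numFactors} {C E : Finset (L.Level k)}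
    (hC : C ∈ (M.part k).parts) (hE : E ∈ (M.part k).parts) (hCE : C ≠ E) (h0 : 0 ∉ C)
    {i j : L.Level k} (hi : i ∈ C) (hj : j ∈ E) :
    ∃ b ∈ M.space, L.levelVec k i ⬝ᵥ b ≠ L.levelVec k j ⬝ᵥ b := by
  classical
  refine ⟨M.A1 *ᵥ Pi.single (Sum.inr (Sum.inr ⟨k, C, hC, h0⟩)) 1, M.A1_mulVec_mem_space _, ?_⟩
  rw [levelVec_dotProduct_A1_mulVec (C := ⟨C, hC, h0⟩) _ hi, Pi.single_eq_same]
  by_cases h0' : 0 ∈ E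
  · rw [levelVec_dotProduct_A1_mulVec_of_zero_mem _ hE h0' hj]
    exact one_ne_zero
  · rw [levelVec_dotProduct_A1_mulVec (C := ⟨E, hE, h0'⟩) _ hj, Pi.single_eq_of_ne]
    · exact one_ne_zero
    · simpa using hCE.symm

theorem mem_part_iff {k : Fin L.numFactors} {i j : L.Level k} :
    j ∈ (M.part k).part i ↔ ∀ b ∈ M.space, L.levelVec k i ⬝ᵥ b = L.levelVec k j ⬝ᵥ b := by
  have hmem : ∀ x, (M.part k).part x ∈ (M.part k).parts := fun x =>
    (M.part k).part_mem.2 (Finset.mem_univ x)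
  have hself : ∀ x, x ∈ (M.part k).part x := fun x => (M.part k).mem_part (Finset.mem_univ x)
  refine ⟨fun h b hb => hb.2 k _ (hmem i) i (hself i) j h, fun h => ?_⟩
  by_contra hij
  have hne : (M.part k).part i ≠ (M.part k).part j := fun hc => hij (hc ▸ hself j)
  by_cases h0 : 0 ∈ (M.part k).part i
  · have h0' : 0 ∉ (M.part k).part j := fun hc =>
      hne ((M.part k).eq_of_mem_parts (hmem i) (hmem j) h0 hc)
    obtain ⟨b, hb, hne⟩ :=
      M.exists_mem_space_levelVec_ne (hmem j) (hmem i) hne.symm h0' (hself j) (hself i)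
    exact hne (h b hb).symm
  · obtain ⟨b, hb, hne⟩ :=
      M.exists_mem_space_levelVec_ne (hmem i) (hmem j) hne h0 (hself i) (hself j)
    exact hne (h b hb)

theorem space_injective : Function.Injective (space : Model L → _) := by
  intro M M' h
  refine Model.ext (Finset.ext fun j => ?_)
    (funext fun k => finpartition_ext_part fun i _ => Finset.ext fun j => ?_)
  · rw [mem_cont_iff, mem_cont_iff, h]
  · rw [mem_part_iff, mem_part_iff, h]

theorem space_full : (full L).space = ⊤ := by
  refine eq_top_iff.2 fun b _ => ⟨fun j hj => absurd (Finset.mem_univ j) hj, ?_⟩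
  intro k C hC i hi j hj
  obtain ⟨x, -, rfl⟩ := Finpartition.mem_bot_iff.1 hC
  rw [Finset.mem_singleton.1 hi, Finset.mem_singleton.1 hj]

theorem size_full : (full L).size = Fintype.card L.Param := by
  rw [size, space_full, finrank_top, Module.finrank_fintype_fun_eq_card]

open Classical in
/-- The feasible model cut out by the elementary constraint vectors in the subspace `W`; because
`W` is a subspace, the equalities of levels in `W` form an equivalence relation. -/
noncomputable def ofConstraints (W : Submodule ℝ (L.Param → ℝ)) : Model L where
  cont := {j | L.contVec j ∉ W}
  part k := Finpartition.ofSetoid (W.quotientRel.comap (L.levelVec k))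

theorem mem_space_ofConstraints {W : Submodule ℝ (L.Param → ℝ)} {b : L.Param → ℝ} :
    b ∈ (ofConstraints W).space ↔ ∀ a ∈ W, IsElementary a → a ⬝ᵥ b = 0 := by
  classical
  have hpart : ∀ k i j, L.levelVec k i - L.levelVec k j ∈ W ↔
      j ∈ ((ofConstraints W).part k).part i := by
    intro k i j
    rw [← Submodule.quotientRel_def, ← Setoid.comap_rel]
    exact Finpartition.mem_part_ofSetoid_iff_rel.symm
  constructor
  · rintro ⟨hc, hl⟩ a ha (⟨j, rfl⟩ | ⟨k, i, j, rfl⟩)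
    · exact hc j (by simpa [ofConstraints] using ha)
    · rw [sub_dotProduct, sub_eq_zero]
      have hi := Finset.mem_univ i
      exact hl k _ (Finpartition.part_mem _ |>.2 hi) i (Finpartition.mem_part _ hi) j
        ((hpart k i j).1 ha)
  · refine fun h => ⟨fun j hj => h _ ?_ (isElementary_contVec j), fun k C hC i hi j hj => ?_⟩
    · simpa [ofConstraints] using hj
    · rw [← sub_eq_zero, ← sub_dotProduct]
      refine h _ ((hpart k i j).2 ?_) (isElementary_levelVec_sub k i j)
      rwa [Finpartition.part_eq_of_mem _ hC hi]

theorem exists_model_mem_space_iff {a : L.Param → ℝ} (ha : IsElementary a) :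
    ∃ M : Model L, ∀ b, b ∈ M.space ↔ a ⬝ᵥ b = 0 := by
  refine ⟨ofConstraints (ℝ ∙ a), fun b => mem_space_ofConstraints.trans ⟨fun h => ?_, ?_⟩⟩
  · exact h a (Submodule.mem_span_singleton_self a) ha
  · rintro h a' ha' -
    obtain ⟨c, rfl⟩ := Submodule.mem_span_singleton.1 ha'
    rw [smul_dotProduct, h, smul_zero]

theorem exists_isElementary_of_notMem_space {β : L.Param → ℝ} (hβ : β ∉ M.space) :
    ∃ a, IsElementary a ∧ a ⬝ᵥ β ≠ 0 ∧ ∀ b ∈ M.space, a ⬝ᵥ b = 0 := by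
  by_contra! h
  refine hβ ⟨fun j hj => ?_, fun k C hC i hi j hj => ?_⟩
  · by_contra hne
    obtain ⟨b, hb, hb'⟩ := h _ (isElementary_contVec j) hne
    exact hb' (hb.1 j hj)
  · by_contra hne
    obtain ⟨b, hb, hb'⟩ := h _ (isElementary_levelVec_sub k i j)
      (by rwa [sub_dotProduct, sub_ne_zero])
    exact hb' (by rw [sub_dotProduct, hb.2 k C hC i hi j hj, sub_self])

variable {M}

theorem IsMinimalTrue.mem_space_iff {β : L.Param → ℝ} (hM : M.IsMinimalTrue β)
    {b : L.Param → ℝ} :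
    b ∈ M.space ↔ ∀ a, IsElementary a → a ⬝ᵥ β = 0 → a ⬝ᵥ b = 0 := by
  let N : Model L := ofConstraints (LinearMap.ker (dotProductBilin ℝ ℝ β))
  have hN : ∀ b, b ∈ N.space ↔ ∀ a, IsElementary a → a ⬝ᵥ β = 0 → a ⬝ᵥ b = 0 := by
    intro b
    rw [mem_space_ofConstraints]
    refine forall_congr' fun a => ?_
    rw [dotProduct_comm a β]
    exact imp.swap
  have hle : N.space ≤ M.space := by
    intro b hb
    refine ⟨fun j hj => (hN b).1 hb _ (isElementary_contVec j) (hM.1.1 j hj),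
      fun k C hC i hi j hj => ?_⟩
    have hij := (hN b).1 hb _ (isElementary_levelVec_sub k i j)
    simp only [sub_dotProduct, sub_eq_zero] at hij
    exact hij (hM.1.2 k C hC i hi j hj)
  have heq : N.space = M.space := Submodule.eq_of_le_of_finrank_le hle
    (hM.2 N ((hN β).2 fun _ _ h => h))
  rw [← heq, hN]

theorem IsMinimalTrue.space_le {β : L.Param → ℝ} (hM : M.IsMinimalTrue β) {M' : Model L}
    (hβ : β ∈ M'.space) : M.space ≤ M'.space := by
  intro b hb
  by_contra hb'
  obtain ⟨a, ha, hab, haM'⟩ := M'.exists_isElementary_of_notMem_space hb'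
  exact hab (hM.mem_space_iff.1 hb a ha (haM' β hβ))

end Space

end Model

/-! ### Least squares -/

section LeastSquares

variable {m ι : Type*} [Fintype m] [Fintype ι]

theorem dotProduct_self_nonneg (v : m → ℝ) : 0 ≤ v ⬝ᵥ v :=
  Finset.sum_nonneg fun i _ => mul_self_nonneg (v i)

theorem dotProduct_sq_le (v w : m → ℝ) : (v ⬝ᵥ w) ^ 2 ≤ (v ⬝ᵥ v) * (w ⬝ᵥ w) := by
  simpa only [dotProduct, sq] using Finset.sum_mul_sq_le_sq_mul_sq Finset.univ v w

theorem ne_zero_of_dotProduct_ne_zero {a b : m → ℝ} (h : a ⬝ᵥ b ≠ 0) : a ≠ 0 := by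
  rintro rfl
  exact h (zero_dotProduct b)

variable {Z : Matrix m ι ℝ}

theorem mulVec_dotProduct (u : ι → ℝ) (v : m → ℝ) : (Z *ᵥ u) ⬝ᵥ v = u ⬝ᵥ (Zᵀ *ᵥ v) := by
  rw [Matrix.dotProduct_mulVec, Matrix.vecMul_transpose]

theorem posDef_gram (hZ : Function.Injective Z.mulVec) : (Zᵀ * Z).PosDef := by
  have := Matrix.PosDef.conjTranspose_mul_self Z hZ
  rwa [Matrix.conjTranspose_eq_transpose_of_trivial] at this

variable [DecidableEq ι]

theorem isUnit_det_gram (hZ : Function.Injective Z.mulVec) : IsUnit (Zᵀ * Z).det :=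
  (posDef_gram hZ).det_pos.ne'.isUnit

/-- The coefficients of the projection of `y` on the column space of `Z`. -/
noncomputable def lsq (Z : Matrix m ι ℝ) (y : m → ℝ) : ι → ℝ := (Zᵀ * Z)⁻¹ *ᵥ (Zᵀ *ᵥ y)

/-- The squared length of the projection of `y` on the column space of `Z`. -/
noncomputable def projSq (Z : Matrix m ι ℝ) (y : m → ℝ) : ℝ := (Z *ᵥ lsq Z y) ⬝ᵥ (Z *ᵥ lsq Z y)

theorem projSq_nonneg (Z : Matrix m ι ℝ) (y : m → ℝ) : 0 ≤ projSq Z y :=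
  dotProduct_self_nonneg _

theorem lsq_add (y y' : m → ℝ) : lsq Z (y + y') = lsq Z y + lsq Z y' := by
  simp only [lsq, Matrix.mulVec_add]

theorem lsq_mulVec (hZ : Function.Injective Z.mulVec) (u : ι → ℝ) : lsq Z (Z *ᵥ u) = u := by
  rw [lsq, Matrix.mulVec_mulVec u, Matrix.mulVec_mulVec,
    Matrix.nonsing_inv_mul _ (isUnit_det_gram hZ), Matrix.one_mulVec]

theorem transpose_mulVec_gram_inv (hZ : Function.Injective Z.mulVec) (a : ι → ℝ) :
    Zᵀ *ᵥ (Z *ᵥ ((Zᵀ * Z)⁻¹ *ᵥ a)) = a := by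
  rw [Matrix.mulVec_mulVec, Matrix.mulVec_mulVec, Matrix.mul_nonsing_inv _ (isUnit_det_gram hZ),
    Matrix.one_mulVec]

theorem mulVec_dotProduct_sub_lsq (hZ : Function.Injective Z.mulVec) (y : m → ℝ) (u : ι → ℝ) :
    (Z *ᵥ u) ⬝ᵥ (y - Z *ᵥ lsq Z y) = 0 := by
  rw [mulVec_dotProduct, Matrix.mulVec_sub, lsq, transpose_mulVec_gram_inv hZ, sub_self,
    dotProduct_zero]

theorem dotProduct_self_sub_mulVec (hZ : Function.Injective Z.mulVec) (y : m → ℝ) (u : ι → ℝ) :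
    (y - Z *ᵥ u) ⬝ᵥ (y - Z *ᵥ u) = (y - Z *ᵥ lsq Z y) ⬝ᵥ (y - Z *ᵥ lsq Z y) +
      (Z *ᵥ (lsq Z y - u)) ⬝ᵥ (Z *ᵥ (lsq Z y - u)) := by
  have horth := mulVec_dotProduct_sub_lsq hZ y (lsq Z y - u)
  have hsplit : y - Z *ᵥ u = (y - Z *ᵥ lsq Z y) + Z *ᵥ (lsq Z y - u) := by
    rw [Matrix.mulVec_sub]; abel
  rw [hsplit, add_dotProduct, dotProduct_add, dotProduct_add, horth,
    dotProduct_comm (y - Z *ᵥ lsq Z y) (Z *ᵥ (lsq Z y - u)), horth, add_zero, zero_add]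

theorem mulVec_gram_inv_dotProduct (hZ : Function.Injective Z.mulVec) (a u : ι → ℝ) :
    (Z *ᵥ ((Zᵀ * Z)⁻¹ *ᵥ a)) ⬝ᵥ (Z *ᵥ u) = a ⬝ᵥ u := by
  rw [dotProduct_comm, mulVec_dotProduct, transpose_mulVec_gram_inv hZ, dotProduct_comm]

theorem dotProduct_sq_le_gram (hZ : Function.Injective Z.mulVec) (a u : ι → ℝ) :
    (a ⬝ᵥ u) ^ 2 ≤ (a ⬝ᵥ ((Zᵀ * Z)⁻¹ *ᵥ a)) * ((Z *ᵥ u) ⬝ᵥ (Z *ᵥ u)) := by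
  have h := dotProduct_sq_le (Z *ᵥ ((Zᵀ * Z)⁻¹ *ᵥ a)) (Z *ᵥ u)
  rwa [mulVec_gram_inv_dotProduct hZ, mulVec_gram_inv_dotProduct hZ] at h

theorem gram_inv_pos (hZ : Function.Injective Z.mulVec) {a : ι → ℝ} (ha : a ≠ 0) :
    0 < a ⬝ᵥ ((Zᵀ * Z)⁻¹ *ᵥ a) := by
  simpa using (posDef_gram hZ).inv.dotProduct_mulVec_pos ha

theorem gram_inv_nonneg (hZ : Function.Injective Z.mulVec) (a : ι → ℝ) :
    0 ≤ a ⬝ᵥ ((Zᵀ * Z)⁻¹ *ᵥ a) := by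
  rw [← mulVec_gram_inv_dotProduct hZ]
  exact dotProduct_self_nonneg _

theorem exists_dotProduct_eq_zero_gram_dist_eq (hZ : Function.Injective Z.mulVec) {a : ι → ℝ}
    (ha : a ≠ 0) (u : ι → ℝ) :
    ∃ b, a ⬝ᵥ b = 0 ∧
      (Z *ᵥ (u - b)) ⬝ᵥ (Z *ᵥ (u - b)) = (a ⬝ᵥ u) ^ 2 / (a ⬝ᵥ ((Zᵀ * Z)⁻¹ *ᵥ a)) := by
  have hQ := gram_inv_pos hZ ha
  refine ⟨u - ((a ⬝ᵥ u) / (a ⬝ᵥ ((Zᵀ * Z)⁻¹ *ᵥ a))) • ((Zᵀ * Z)⁻¹ *ᵥ a), ?_, ?_⟩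
  · rw [dotProduct_sub, dotProduct_smul, smul_eq_mul, div_mul_cancel₀ _ hQ.ne', sub_self]
  · rw [sub_sub_cancel, Matrix.mulVec_smul, smul_dotProduct, dotProduct_smul,
      mulVec_gram_inv_dotProduct hZ, smul_eq_mul, smul_eq_mul]
    field_simp

end LeastSquares

/-! ### Constrained estimators -/

section Estimation

open Layout

variable {L : Layout} {n : ℕ} {D : Data L n}

theorem rssOf_eq (y : Fin n → ℝ) (b : L.Param → ℝ) :
    rssOf D y b = (y - D.X *ᵥ b) ⬝ᵥ (y - D.X *ᵥ b) := by
  simp only [rssOf, dotProduct, sq, Pi.sub_apply]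

theorem Z1_mulVec (M : Model L) (u : M.Free → ℝ) : Z1 D M *ᵥ u = D.X *ᵥ (M.A1 *ᵥ u) := by
  rw [Z1, Matrix.mulVec_mulVec]

theorem Z1_mulVec_injective (hX : Function.Injective D.X.mulVec) (M : Model L) :
    Function.Injective (Z1 D M).mulVec := by
  intro u u' h
  rw [Z1_mulVec, Z1_mulVec] at h
  exact M.A1_mulVec_injective (hX h)

theorem X_mulVec_betaHat (y : Fin n → ℝ) (M : Model L) :
    D.X *ᵥ betaHat D y M = Z1 D M *ᵥ lsq (Z1 D M) y :=
  (Z1_mulVec M _).symm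

theorem betaHat_mem_space (y : Fin n → ℝ) (M : Model L) : betaHat D y M ∈ M.space :=
  M.A1_mulVec_mem_space _

theorem rss_le (hX : Function.Injective D.X.mulVec) (y : Fin n → ℝ) (M : Model L)
    {b : L.Param → ℝ} (hb : b ∈ M.space) : rss D y M ≤ rssOf D y b := by
  obtain ⟨u, rfl⟩ := M.exists_A1_mulVec_eq hb
  rw [rss, rssOf_eq, rssOf_eq, X_mulVec_betaHat, ← Z1_mulVec,
    dotProduct_self_sub_mulVec (Z1_mulVec_injective hX M) y u]
  exact le_add_of_nonneg_right (dotProduct_self_nonneg _)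

theorem rssOf_eq_olsFull_add (hX : Function.Injective D.X.mulVec) (y : Fin n → ℝ)
    (b : L.Param → ℝ) :
    rssOf D y b = rssOf D y (olsFull D y) +
      (D.X *ᵥ (olsFull D y - b)) ⬝ᵥ (D.X *ᵥ (olsFull D y - b)) := by
  rw [rssOf_eq, rssOf_eq]
  exact dotProduct_self_sub_mulVec hX y b

theorem loss_eq_rss (hX : Function.Injective D.X.mulVec) (β : L.Param → ℝ) (M : Model L) :
    loss D β M = rss D (D.X *ᵥ β) M := by
  set v := D.X *ᵥ β with hv
  have hfit : hat D M *ᵥ v = D.X *ᵥ betaHat D v M := by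
    rw [X_mulVec_betaHat]
    simp only [hat, lsq, Matrix.mulVec_mulVec, Matrix.mul_assoc]
  have horth : (D.X *ᵥ betaHat D v M) ⬝ᵥ (v - D.X *ᵥ betaHat D v M) = 0 := by
    rw [X_mulVec_betaHat]
    exact mulVec_dotProduct_sub_lsq (Z1_mulVec_injective hX M) v _
  rw [loss, rss, rssOf_eq, Matrix.sub_mulVec, Matrix.one_mulVec, ← hv, hfit, sub_dotProduct v,
    horth, sub_zero]

theorem loss_le (hX : Function.Injective D.X.mulVec) (β : L.Param → ℝ) (M : Model L)
    {b : L.Param → ℝ} (hb : b ∈ M.space) :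
    loss D β M ≤ (D.X *ᵥ (β - b)) ⬝ᵥ (D.X *ᵥ (β - b)) := by
  rw [loss_eq_rss hX, Matrix.mulVec_sub, ← rssOf_eq]
  exact rss_le hX _ M hb

theorem minLoss_le (hX : Function.Injective D.X.mulVec) {β : L.Param → ℝ} {T : Model L}
    (hT : β ∈ T.space) {a : L.Param → ℝ} (ha : IsElementary a) (haβ : a ⬝ᵥ β ≠ 0) :
    minLoss D β T ≤ ENNReal.ofReal ((a ⬝ᵥ β) ^ 2 / (a ⬝ᵥ ((D.Xᵀ * D.X)⁻¹ *ᵥ a))) := by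
  have ha0 := ne_zero_of_dotProduct_ne_zero haβ
  obtain ⟨M, hM⟩ := Model.exists_model_mem_space_iff ha
  obtain ⟨b, hab, hb⟩ := exists_dotProduct_eq_zero_gram_dist_eq hX ha0 β
  have hsize : M.size + 1 = (Model.full L).size := by
    rw [Model.size_full, Model.size, finrank_add_one_of_mem_iff_dotProduct_eq_zero ha0 hM]
  have hTM : ¬ T.space ≤ M.space := fun h => haβ ((hM β).1 (h hT))
  refine (iInf₂_le M ⟨hsize, hTM⟩).trans (ENNReal.ofReal_le_ofReal ?_)
  exact (loss_le hX β M ((hM b).2 hab)).trans_eq hb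

end Estimation

/-! ### The path of models when the t-statistics are well separated -/

theorem exists_fin_lt_iff {N : ℕ} {p : Fin N → Prop} (hp : ∀ i j, i ≤ j → p j → p i) :
    ∃ m : Fin (N + 1), ∀ i : Fin N, (i : ℕ) < m ↔ p i := by
  by_cases h : ∃ i, ¬ p i
  · obtain ⟨m, hm, hmin⟩ := WellFounded.has_min wellFounded_lt {i | ¬ p i} h
    refine ⟨m.castSucc, fun i => ⟨fun hi => ?_, fun hi => ?_⟩⟩
    · by_contra hpi
      exact hmin i hpi hi
    · by_contra hmi
      exact hm (hp m i (not_lt.1 hmi) hi)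
  · push Not at h
    exact ⟨Fin.last N, fun i => iff_of_true i.2 (h i)⟩

section Path

open Layout

variable {L : Layout} {n : ℕ} {D : Data L n} {y : Fin n → ℝ} {β : L.Param → ℝ} {lo hi : ℝ}

/-- The squared t-statistic is at most `lo` for the elementary constraints that `β` satisfies and at
least `hi` for those that it violates. -/
def TSqSeparates (D : Data L n) (y : Fin n → ℝ) (β : L.Param → ℝ) (lo hi : ℝ) : Prop :=
  ∀ a, IsElementary a → (a ⬝ᵥ β = 0 → tSq D y a ≤ lo) ∧ (a ⬝ᵥ β ≠ 0 → hi ≤ tSq D y a)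

theorem TSqSeparates.separates_dissim (h : TSqSeparates D y β lo hi) (k : Fin L.numFactors) :
    Clustering.Separates (dissim D y k) (fun i => L.levelVec k i ⬝ᵥ β) lo hi := by
  intro i j
  simpa only [dissim, sub_dotProduct, sub_eq_zero, ne_eq] using
    h _ (isElementary_levelVec_sub k i j)

variable (c : ∀ k, Clustering (dissim D y k))

theorem isElementary_stepVec (s : L.Step) : IsElementary (stepVec D y c s) := by
  rcases s with j | q
  · exact isElementary_contVec j
  · exact isElementary_levelVec_sub _ _ _

theorem TSqSeparates.stepHeight_le_or_le (h : TSqSeparates D y β lo hi) (hlohi : lo < hi)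
    (s : L.Step) :
    (stepHeight D y c s ≤ lo ∧ stepVec D y c s ⬝ᵥ β = 0) ∨
      (hi ≤ stepHeight D y c s ∧ stepVec D y c s ⬝ᵥ β ≠ 0) := by
  rcases s with j | ⟨k, s⟩
  · have hj := h _ (isElementary_contVec j)
    exact (em _).imp (fun h0 => ⟨hj.1 h0, h0⟩) (fun h0 => ⟨hj.2 h0, h0⟩)
  · have := (c k).height_le_or_le_height hlohi (h.separates_dissim k) s.2
    simpa only [stepHeight, stepVec, sub_dotProduct, sub_eq_zero, ne_eq] using this

theorem TSqSeparates.dotProduct_eq_zero_of_stepHeight_le (h : TSqSeparates D y β lo hi)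
    (hlohi : lo < hi) {s : L.Step} (hs : stepHeight D y c s ≤ lo) : stepVec D y c s ⬝ᵥ β = 0 :=
  (h.stepHeight_le_or_le c hlohi s).elim (·.2) fun h' =>
    absurd (h'.1.trans hs) (not_le.2 hlohi)

theorem TSqSeparates.mem_space_iff_steps (h : TSqSeparates D y β lo hi) (hlohi : lo < hi)
    {T : Model L} (hT : T.IsMinimalTrue β) {b : L.Param → ℝ} :
    b ∈ T.space ↔ ∀ s, stepVec D y c s ⬝ᵥ β = 0 → stepVec D y c s ⬝ᵥ b = 0 := by
  rw [hT.mem_space_iff]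
  refine ⟨fun hb s => hb _ (isElementary_stepVec c s), fun hb a ha haβ => ?_⟩
  rcases ha with ⟨j, rfl⟩ | ⟨k, i, j, rfl⟩
  · exact hb (Sum.inl j) haβ
  · rw [sub_dotProduct, sub_eq_zero] at haβ ⊢
    refine (c k).eq_of_eq_at_low_steps (g := fun i => L.levelVec k i ⬝ᵥ b) hlohi
      (h.separates_dissim k) (fun s hs hslo => ?_) haβ
    have hsb := hb (Sum.inr ⟨k, s, hs⟩) (h.dotProduct_eq_zero_of_stepHeight_le c hlohi hslo)
    rwa [stepVec, sub_dotProduct, sub_eq_zero] at hsb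

theorem TSqSeparates.exists_path_eq (h : TSqSeparates D y β lo hi) (hlohi : lo < hi)
    {T : Model L} (hT : T.IsMinimalTrue β) {e : Fin (Fintype.card L.Step) ≃ L.Step}
    (hmono : Monotone fun i => stepHeight D y c (e i))
    {path : Fin (Fintype.card L.Step + 1) → Model L}
    (hpath : ∀ m, ∀ b : L.Param → ℝ, b ∈ (path m).space ↔
      ∀ i : Fin (Fintype.card L.Step), (i : ℕ) < (m : ℕ) → stepVec D y c (e i) ⬝ᵥ b = 0) :
    ∃ m, path m = T := by
  have hlower : ∀ i j, i ≤ j → stepVec D y c (e j) ⬝ᵥ β = 0 → stepVec D y c (e i) ⬝ᵥ β = 0 := by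
    intro i j hij hj
    have hjlo : stepHeight D y c (e j) ≤ lo :=
      (h.stepHeight_le_or_le c hlohi (e j)).elim (·.1) fun h' => absurd hj h'.2
    exact h.dotProduct_eq_zero_of_stepHeight_le c hlohi ((hmono hij).trans hjlo)
  obtain ⟨m, hm⟩ := exists_fin_lt_iff hlower
  refine ⟨m, Model.space_injective (Submodule.ext fun b => ?_)⟩
  simp only [hpath, h.mem_space_iff_steps c hlohi hT, hm]
  exact e.forall_congr_right (q := fun s => stepVec D y c s ⬝ᵥ β = 0 → stepVec D y c s ⬝ᵥ b = 0)

theorem TSqSeparates.eq_of_isOutput (h : TSqSeparates D y β lo hi) (hlohi : lo < hi)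
    {T : Model L} (hT : T.IsMinimalTrue β) {r : ℝ} (hgic : ∀ M ≠ T, gic D y r T < gic D y r M)
    {M : Model L} (hM : IsOutput D y r M) : M = T := by
  obtain ⟨c, e, path, hmono, hpath, m, rfl, hmin⟩ := hM
  obtain ⟨m₀, rfl⟩ := h.exists_path_eq c hlohi hT hmono hpath
  by_contra hne
  exact (hgic _ hne).not_ge (hmin m₀)

end Path

/-! ### The selected model for errors of moderate size -/

section RealInequalities

variable {a b c n w r δ C : ℝ}

theorem log_sub_log_le (ha : 0 < a) (hb : 0 < b) : Real.log a - Real.log b ≤ (a - b) / b := by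
  rw [← Real.log_div ha.ne' hb.ne', sub_div, div_self hb.ne']
  exact Real.log_le_sub_one_of_pos (div_pos ha hb)

theorem mul_log_sub_log_lt (hn : 0 < n) (hc : 0 < c) (ha : 0 < a) (hb : c * n ≤ b)
    (hw : 0 ≤ w) (hab : a - b ≤ w) (hwr : w < c * r) : n * (Real.log a - Real.log b) < r := by
  have hb0 : 0 < b := (mul_pos hc hn).trans_le hb
  calc n * (Real.log a - Real.log b) ≤ n * ((a - b) / b) := by
        gcongr
        exact log_sub_log_le ha hb0
    _ ≤ n * (w / (c * n)) := by gcongr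
    _ = w / c := by field_simp
    _ < r := (div_lt_iff₀' hc).2 hwr

theorem le_mul_log_sub_log (hn : 0 < n) (ha : 0 < a) (hC : a ≤ C * n) (hδ : 0 < δ) (hδn : δ ≤ n)
    (hab : a + δ / 2 ≤ b) : δ / (2 * C + 1) ≤ n * (Real.log b - Real.log a) := by
  have hb : 0 < b := by linarith
  have hC0 : 0 < C := pos_of_mul_pos_left (ha.trans_le hC) hn.le
  have hratio : a / b ≤ a / (a + δ / 2) := by gcongr
  calc δ / (2 * C + 1) = n * (δ / ((2 * C + 1) * n)) := by field_simp
    _ ≤ n * (δ / (2 * a + δ)) := by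
        gcongr
        linarith
    _ = n * (1 - a / (a + δ / 2)) := by
        field_simp
        ring
    _ ≤ n * (1 - a / b) := by gcongr
    _ ≤ n * (Real.log b - Real.log a) := by
        have hlog := log_sub_log_le ha hb
        rw [sub_div, div_self hb.ne'] at hlog
        exact mul_le_mul_of_nonneg_left (by linarith) hn.le

theorem nine_sixteenths_mul_le_add_sq {x z : ℝ} (hx : δ ≤ x ^ 2) (hz : 16 * z ^ 2 ≤ δ) :
    9 / 16 * δ ≤ (x + z) ^ 2 := by
  nlinarith [sq_nonneg (x / 2 + 2 * z)]

end RealInequalities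

section Response

open Layout

variable {L : Layout} {n : ℕ} {D : Data L n} {β : L.Param → ℝ} {T : Model L} {e : Fin n → ℝ}

theorem olsFull_response (hX : Function.Injective D.X.mulVec) :
    olsFull D (D.X *ᵥ β + e) = β + olsFull D e :=
  (lsq_add _ _).trans (congrArg (· + lsq D.X e) (lsq_mulVec hX β))

theorem rssOf_response : rssOf D (D.X *ᵥ β + e) β = e ⬝ᵥ e := by
  rw [rssOf_eq, add_sub_cancel_left]

theorem rssOf_olsFull_response (hX : Function.Injective D.X.mulVec) :
    rssOf D (D.X *ᵥ β + e) (olsFull D (D.X *ᵥ β + e)) = e ⬝ᵥ e - projSq D.X e := by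
  rw [eq_sub_iff_add_eq, ← rssOf_response (D := D) (β := β), rssOf_eq_olsFull_add hX _ β,
    olsFull_response hX, add_sub_cancel_left]
  rfl

theorem rss_response_le (hX : Function.Injective D.X.mulVec) (hT : β ∈ T.space) :
    rss D (D.X *ᵥ β + e) T ≤ e ⬝ᵥ e :=
  (rss_le hX _ T hT).trans_eq rssOf_response

theorem le_rss_response (hX : Function.Injective D.X.mulVec) (M : Model L) :
    e ⬝ᵥ e - projSq D.X e ≤ rss D (D.X *ᵥ β + e) M := by
  rw [← rssOf_olsFull_response (β := β) hX, rss, rssOf_eq_olsFull_add hX _ (betaHat D _ M)]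
  exact le_add_of_nonneg_right (dotProduct_self_nonneg _)

theorem sq_dotProduct_olsFull_le (hX : Function.Injective D.X.mulVec) {a : L.Param → ℝ}
    (ha : a ⬝ᵥ β = 0) :
    (a ⬝ᵥ olsFull D (D.X *ᵥ β + e)) ^ 2 ≤ (a ⬝ᵥ ((D.Xᵀ * D.X)⁻¹ *ᵥ a)) * projSq D.X e := by
  rw [olsFull_response hX, dotProduct_add, ha, zero_add]
  exact dotProduct_sq_le_gram hX a _

variable {δ : ℝ}

theorem le_sq_dotProduct_olsFull (hX : Function.Injective D.X.mulVec) (hT : β ∈ T.space)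
    (hδ : ENNReal.ofReal δ ≤ minLoss D β T) (he : 16 * projSq D.X e ≤ δ)
    {a : L.Param → ℝ} (ha : IsElementary a) (haβ : a ⬝ᵥ β ≠ 0) :
    9 / 16 * δ * (a ⬝ᵥ ((D.Xᵀ * D.X)⁻¹ *ᵥ a)) ≤ (a ⬝ᵥ olsFull D (D.X *ᵥ β + e)) ^ 2 := by
  have hQ := gram_inv_pos hX (ne_zero_of_dotProduct_ne_zero haβ)
  have hsignal := hδ.trans (minLoss_le hX hT ha haβ)
  rw [ENNReal.ofReal_le_ofReal_iff (by positivity), le_div_iff₀ hQ] at hsignal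
  have hnoise : (a ⬝ᵥ olsFull D e) ^ 2 ≤ (a ⬝ᵥ ((D.Xᵀ * D.X)⁻¹ *ᵥ a)) * projSq D.X e :=
    dotProduct_sq_le_gram hX a (olsFull D e)
  rw [olsFull_response hX, dotProduct_add, mul_assoc]
  exact nine_sixteenths_mul_le_add_sq hsignal (by nlinarith)

theorem tSqSeparates_response (hX : Function.Injective D.X.mulVec) (hT : β ∈ T.space)
    (hδ : ENNReal.ofReal δ ≤ minLoss D β T) (he : 16 * projSq D.X e ≤ δ)
    (hS : 0 < sigmaHatSq D (D.X *ᵥ β + e)) :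
    TSqSeparates D (D.X *ᵥ β + e) β (δ / 16 / sigmaHatSq D (D.X *ᵥ β + e))
      (9 / 16 * δ / sigmaHatSq D (D.X *ᵥ β + e)) := by
  refine fun a ha => ⟨fun haβ => ?_, fun haβ => ?_⟩ <;>
    rw [tSq, mul_comm (sigmaHatSq D _), ← div_div] <;>
    refine div_le_div_of_nonneg_right ?_ hS.le
  · have hQ := gram_inv_nonneg hX a
    have he0 := projSq_nonneg D.X e
    refine div_le_of_le_mul₀ hQ (by linarith) ((sq_dotProduct_olsFull_le hX haβ).trans ?_)
    nlinarith
  · rw [le_div_iff₀ (gram_inv_pos hX (ne_zero_of_dotProduct_ne_zero haβ))]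
    exact le_sq_dotProduct_olsFull hX hT hδ he ha haβ

theorem rss_response_add_le (hX : Function.Injective D.X.mulVec) (hT : β ∈ T.space)
    (hδ : ENNReal.ofReal δ ≤ minLoss D β T) (he : 16 * projSq D.X e ≤ δ) {M : Model L}
    (hM : β ∉ M.space) :
    rss D (D.X *ᵥ β + e) T + δ / 2 ≤ rss D (D.X *ᵥ β + e) M := by
  obtain ⟨a, ha, haβ, haM⟩ := M.exists_isElementary_of_notMem_space hM
  set y := D.X *ᵥ β + e with hy
  have hQ := gram_inv_pos hX (ne_zero_of_dotProduct_ne_zero haβ)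
  have hdist : 9 / 16 * δ ≤ (D.X *ᵥ (olsFull D y - betaHat D y M)) ⬝ᵥ
      (D.X *ᵥ (olsFull D y - betaHat D y M)) := by
    have h := dotProduct_sq_le_gram hX a (olsFull D y - betaHat D y M)
    rw [dotProduct_sub, haM _ (betaHat_mem_space y M), sub_zero] at h
    refine le_of_mul_le_mul_right ?_ hQ
    rw [mul_comm (_ ⬝ᵥ (D.X *ᵥ _))]
    exact (le_sq_dotProduct_olsFull hX hT hδ he ha haβ).trans h
  have hrssM := rssOf_eq_olsFull_add hX y (betaHat D y M)
  rw [← rss, hy, rssOf_olsFull_response hX, ← hy] at hrssM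
  have hrssT : rss D y T ≤ e ⬝ᵥ e := rss_response_le hX hT
  linarith

/-- The errors `e` are such that the procedure recovers the true model: their projection is small
compared with the penalty `r` and with a lower bound `δ` of the losses, and their squared length is
of the order of `n`, up to the factors `c` and `C`. -/
structure ModerateErrors (D : Data L n) (β : L.Param → ℝ) (T : Model L) (r δ c C : ℝ)
    (e : Fin n → ℝ) : Prop where
  injective : Function.Injective D.X.mulVec
  c_pos : 0 < c
  params_lt : L.numParams < n
  δ_le : δ ≤ n
  δ_le_minLoss : ENNReal.ofReal δ ≤ minLoss D β T
  penalty_lt : r * T.size < δ / (2 * C + 1)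
  proj_le : 16 * projSq D.X e ≤ δ
  proj_lt : projSq D.X e < c * r
  mul_le : c * n ≤ e ⬝ᵥ e - projSq D.X e
  le_mul : e ⬝ᵥ e ≤ C * n

namespace ModerateErrors

variable {r c C : ℝ}

theorem n_pos (h : ModerateErrors D β T r δ c C e) : (0 : ℝ) < n :=
  Nat.cast_pos.2 ((Nat.zero_le _).trans_lt h.params_lt)

theorem penalty_pos (h : ModerateErrors D β T r δ c C e) : 0 < r :=
  pos_of_mul_pos_right ((projSq_nonneg D.X e).trans_lt h.proj_lt) h.c_pos.le

theorem C_pos (h : ModerateErrors D β T r δ c C e) : 0 < C := by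
  have h0 := mul_pos h.c_pos h.n_pos
  have hproj := projSq_nonneg D.X e
  exact pos_of_mul_pos_left (by linarith [h.mul_le, h.le_mul]) h.n_pos.le

theorem δ_pos (h : ModerateErrors D β T r δ c C e) : 0 < δ := by
  have hC := h.C_pos
  have hr := h.penalty_pos
  have h0 : 0 ≤ r * T.size := by positivity
  exact (div_pos_iff_of_pos_right (by positivity)).1 (h0.trans_lt h.penalty_lt)

theorem rss_pos (h : ModerateErrors D β T r δ c C e) (M : Model L) :
    0 < rss D (D.X *ᵥ β + e) M :=
  (mul_pos h.c_pos h.n_pos).trans_le (h.mul_le.trans (le_rss_response h.injective M))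

theorem sigmaHatSq_pos (h : ModerateErrors D β T r δ c C e) :
    0 < sigmaHatSq D (D.X *ᵥ β + e) := by
  rw [sigmaHatSq, rssOf_olsFull_response h.injective]
  refine div_pos ((mul_pos h.c_pos h.n_pos).trans_le h.mul_le) (sub_pos.2 ?_)
  exact_mod_cast h.params_lt

theorem gic_lt_of_space_lt (h : ModerateErrors D β T r δ c C e) (hT : β ∈ T.space)
    {M : Model L} (hM : T.space < M.space) :
    gic D (D.X *ᵥ β + e) r T < gic D (D.X *ᵥ β + e) r M := by
  have hX := h.injective
  have hrss : rss D (D.X *ᵥ β + e) T - rss D (D.X *ᵥ β + e) M ≤ projSq D.X e := by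
    linarith [rss_response_le (e := e) hX hT, le_rss_response (β := β) (e := e) hX M]
  have hlog := mul_log_sub_log_lt h.n_pos h.c_pos (h.rss_pos T)
    (h.mul_le.trans (le_rss_response hX M)) (projSq_nonneg _ _) hrss h.proj_lt
  have hsize : (T.size : ℝ) + 1 ≤ M.size := by
    exact_mod_cast Submodule.finrank_lt_finrank_of_lt hM
  rw [gic, gic]
  nlinarith [h.penalty_pos]

theorem gic_lt_of_notMem_space (h : ModerateErrors D β T r δ c C e) (hT : β ∈ T.space)
    {M : Model L} (hM : β ∉ M.space) :
    gic D (D.X *ᵥ β + e) r T < gic D (D.X *ᵥ β + e) r M := by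
  have hX := h.injective
  have hlog := le_mul_log_sub_log h.n_pos (h.rss_pos T)
    ((rss_response_le hX hT).trans h.le_mul) h.δ_pos h.δ_le
    (rss_response_add_le hX hT h.δ_le_minLoss h.proj_le hM)
  have hsize : 0 ≤ r * (M.size : ℝ) := mul_nonneg h.penalty_pos.le M.size.cast_nonneg
  rw [gic, gic]
  linarith [h.penalty_lt]

theorem gic_lt_of_ne (h : ModerateErrors D β T r δ c C e) (hT : T.IsMinimalTrue β)
    {M : Model L} (hM : M ≠ T) :
    gic D (D.X *ᵥ β + e) r T < gic D (D.X *ᵥ β + e) r M := by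
  by_cases hβ : β ∈ M.space
  · exact h.gic_lt_of_space_lt hT.1
      ((hT.space_le hβ).lt_of_ne fun heq => hM (Model.space_injective heq).symm)
  · exact h.gic_lt_of_notMem_space hT.1 hβ

theorem eq_of_isOutput (h : ModerateErrors D β T r δ c C e) (hT : T.IsMinimalTrue β)
    {M : Model L} (hM : IsOutput D (D.X *ᵥ β + e) r M) : M = T := by
  refine (tSqSeparates_response h.injective hT.1 h.δ_le_minLoss h.proj_le
    h.sigmaHatSq_pos).eq_of_isOutput ?_ hT (fun _ => h.gic_lt_of_ne hT) hM
  have hS := h.sigmaHatSq_pos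
  have hδ := h.δ_pos
  gcongr
  linarith

end ModerateErrors

end Response

/-! ### Independent errors -/

section ProjectionSize

variable {m ι : Type*} [Fintype m] [Fintype ι] [DecidableEq ι] {Z : Matrix m ι ℝ}

theorem hat_transpose (Z : Matrix m ι ℝ) :
    (Z * (Zᵀ * Z)⁻¹ * Zᵀ)ᵀ = Z * (Zᵀ * Z)⁻¹ * Zᵀ := by
  simp only [Matrix.transpose_mul, Matrix.transpose_transpose, Matrix.transpose_nonsing_inv,
    Matrix.mul_assoc]

theorem hat_mul_hat (hZ : Function.Injective Z.mulVec) :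
    (Z * (Zᵀ * Z)⁻¹ * Zᵀ) * (Z * (Zᵀ * Z)⁻¹ * Zᵀ) = Z * (Zᵀ * Z)⁻¹ * Zᵀ := by
  calc (Z * (Zᵀ * Z)⁻¹ * Zᵀ) * (Z * (Zᵀ * Z)⁻¹ * Zᵀ)
      = Z * ((Zᵀ * Z)⁻¹ * (Zᵀ * Z)) * (Zᵀ * Z)⁻¹ * Zᵀ := by simp only [Matrix.mul_assoc]
    _ = Z * (Zᵀ * Z)⁻¹ * Zᵀ := by
        rw [Matrix.nonsing_inv_mul _ (isUnit_det_gram hZ), Matrix.mul_one]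

theorem trace_hat (hZ : Function.Injective Z.mulVec) :
    (Z * (Zᵀ * Z)⁻¹ * Zᵀ).trace = Fintype.card ι := by
  rw [Matrix.trace_mul_comm, ← Matrix.mul_assoc, Matrix.mul_nonsing_inv _ (isUnit_det_gram hZ),
    Matrix.trace_one]

theorem sum_row_hat_dotProduct_self (hZ : Function.Injective Z.mulVec) :
    ∑ i, (Z * (Zᵀ * Z)⁻¹ * Zᵀ).row i ⬝ᵥ (Z * (Zᵀ * Z)⁻¹ * Zᵀ).row i = Fintype.card ι := by
  rw [← trace_hat hZ]
  conv_rhs => rw [← hat_mul_hat hZ]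
  nth_rw 4 [← hat_transpose Z]
  rfl

theorem projSq_eq_sum_sq (Z : Matrix m ι ℝ) (e : m → ℝ) :
    projSq Z e = ∑ i, ((Z * (Zᵀ * Z)⁻¹ * Zᵀ).row i ⬝ᵥ e) ^ 2 := by
  rw [projSq, lsq, Matrix.mulVec_mulVec, Matrix.mulVec_mulVec]
  simp only [dotProduct, Matrix.mulVec, Matrix.row_apply, sq]

theorem measurable_projSq (Z : Matrix m ι ℝ) : Measurable (projSq Z) := by
  rw [funext (projSq_eq_sum_sq Z)]
  simp only [dotProduct]
  fun_prop

variable {μ : Measure ℝ} [IsProbabilityMeasure μ]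

theorem memLp_two_dotProduct (hμ : MemLp id 2 μ) (w : m → ℝ) :
    MemLp (fun e => w ⬝ᵥ e) 2 (Measure.pi fun _ : m => μ) :=
  memLp_finsetSum _ fun i _ =>
    (hμ.const_mul (w i)).comp_measurePreserving (measurePreserving_eval (fun _ : m => μ) i)

theorem integral_dotProduct (hμ : Integrable id μ) (hμ0 : ∫ x, x ∂μ = 0) (w : m → ℝ) :
    ∫ e, w ⬝ᵥ e ∂(Measure.pi fun _ : m => μ) = 0 := by
  have hint (i : m) : Integrable (fun e : m → ℝ => e i) (Measure.pi fun _ => μ) :=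
    integrable_comp_eval (μ := fun _ : m => μ) hμ
  have heval (i : m) : ∫ e : m → ℝ, e i ∂(Measure.pi fun _ => μ) = 0 :=
    (integral_comp_eval (μ := fun _ : m => μ) hμ.aestronglyMeasurable).trans hμ0
  simp only [dotProduct]
  rw [integral_finsetSum _ fun i _ => (hint i).const_mul (w i)]
  simp only [integral_const_mul, heval, mul_zero, Finset.sum_const_zero]

theorem integral_sq_dotProduct (hμ : MemLp id 2 μ) (hμ0 : ∫ x, x ∂μ = 0) (w : m → ℝ) :
    ∫ e, (w ⬝ᵥ e) ^ 2 ∂(Measure.pi fun _ : m => μ) = Var[id; μ] * (w ⬝ᵥ w) := by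
  rw [← variance_of_integral_eq_zero (memLp_two_dotProduct hμ w).aemeasurable
    (integral_dotProduct (hμ.integrable (by norm_num)) hμ0 w)]
  have hsum : (fun e : m → ℝ => w ⬝ᵥ e) = ∑ i, fun e : m → ℝ => (fun x => w i * id x) (e i) := by
    funext e
    simp only [dotProduct, Finset.sum_apply, id]
  rw [hsum, variance_sum_pi fun i => hμ.const_mul (w i), dotProduct, Finset.mul_sum]
  refine Finset.sum_congr rfl fun i _ => ?_
  rw [variance_const_mul]
  ring

theorem integrable_projSq (hμ : MemLp id 2 μ) (Z : Matrix m ι ℝ) :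
    Integrable (projSq Z) (Measure.pi fun _ : m => μ) := by
  rw [funext (projSq_eq_sum_sq Z)]
  exact integrable_finsetSum _ fun i _ => (memLp_two_dotProduct hμ _).integrable_sq

theorem integral_projSq (hμ : MemLp id 2 μ) (hμ0 : ∫ x, x ∂μ = 0)
    (hZ : Function.Injective Z.mulVec) :
    ∫ e, projSq Z e ∂(Measure.pi fun _ : m => μ) = Var[id; μ] * Fintype.card ι := by
  simp_rw [projSq_eq_sum_sq]
  rw [integral_finsetSum _ fun i _ => (memLp_two_dotProduct hμ _).integrable_sq]
  simp_rw [integral_sq_dotProduct hμ hμ0]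
  rw [← Finset.mul_sum, sum_row_hat_dotProduct_self hZ]

theorem measure_le_projSq_le (hμ : MemLp id 2 μ) (hμ0 : ∫ x, x ∂μ = 0)
    (hZ : Function.Injective Z.mulVec) {c : ℝ} (hc : 0 < c) :
    (Measure.pi fun _ : m => μ) {e | c ≤ projSq Z e} ≤
      ENNReal.ofReal (Var[id; μ] * Fintype.card ι / c) := by
  have hmarkov := mul_meas_ge_le_integral_of_nonneg
    (Eventually.of_forall fun e => projSq_nonneg Z e) (integrable_projSq hμ Z) c
  rw [integral_projSq hμ hμ0 hZ, mul_comm, ← le_div_iff₀ hc] at hmarkov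
  rw [← ofReal_measureReal]
  exact ENNReal.ofReal_le_ofReal hmarkov

end ProjectionSize

section WeakLaw

theorem measurePreserving_infinitePi_comp {κ ι : Type*} [Fintype κ] {X : Type*}
    [MeasurableSpace X] (μ : Measure X) [IsProbabilityMeasure μ] {g : κ → ι} (hg : g.Injective) :
    MeasurePreserving (fun ω : ι → X => ω ∘ g) (Measure.infinitePi fun _ => μ)
      (Measure.pi fun _ => μ) := by
  have hindep := (iIndepFun_infinitePi (P := fun _ : ι => μ) (X := fun _ x => x)
    fun _ => measurable_id).precomp hg
  refine ⟨by fun_prop, ?_⟩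
  rw [iIndepFun_iff_map_fun_eq_pi_map fun _ => (by fun_prop : Measurable _).aemeasurable] at hindep
  exact hindep.trans (congrArg _ (funext fun i => Measure.infinitePi_map_eval _ (g i)))

theorem tendsto_measure_pi_le_abs_sum_sub {X : Type*} [MeasurableSpace X] {μ : Measure X}
    [IsProbabilityMeasure μ] {f : X → ℝ} (hf : Measurable f) (hfi : Integrable f μ) {η : ℝ}
    (hη : 0 < η) :
    Tendsto (fun n : ℕ => (Measure.pi fun _ : Fin n => μ)
      {e | η * n ≤ |∑ i, f (e i) - n * ∫ x, f x ∂μ|}) atTop (𝓝 0) := by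
  set Q : Measure (ℕ → X) := Measure.infinitePi fun _ => μ
  have heval (i : ℕ) : MeasurePreserving (fun ω : ℕ → X => ω i) Q μ :=
    measurePreserving_eval_infinitePi (fun _ => μ) i
  have hmean : ∫ ω, f (ω 0) ∂Q = ∫ x, f x ∂μ :=
    (heval 0).hasLaw.integral_comp hf.aestronglyMeasurable
  have hlaw := strong_law_ae_real (μ := Q) (fun i ω => f (ω i))
    ((heval 0).integrable_comp_of_integrable hfi)
    (fun i j hij => (iIndepFun_infinitePi (P := fun _ : ℕ => μ) (X := fun _ => f)
      fun _ => hf).indepFun hij)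
    (fun i => ((heval i).hasLaw.identDistrib (heval 0).hasLaw).comp hf)
  have hmeas := tendstoInMeasure_of_tendsto_ae
    (fun n => Measurable.aestronglyMeasurable (by fun_prop)) hlaw
  rw [tendstoInMeasure_iff_norm] at hmeas
  refine (hmeas η hη).congr' ?_
  filter_upwards [eventually_gt_atTop 0] with n hn
  have hn' : (0 : ℝ) < n := Nat.cast_pos.2 hn
  rw [← (measurePreserving_infinitePi_comp μ Fin.val_injective).measure_preimage
    (measurableSet_le measurable_const (by fun_prop)).nullMeasurableSet]
  congr 1 with ω
  simp only [Set.preimage_ofPred_eq, Set.mem_ofPred_eq, hmean, Real.norm_eq_abs,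
    Function.comp_apply, Fin.sum_univ_eq_sum_range fun i => f (ω i)]
  rw [← le_div_iff₀ hn', ← abs_of_pos hn', ← abs_div, sub_div, abs_of_pos hn',
    mul_div_cancel_left₀ _ hn'.ne']

theorem tendsto_measure_pi_le_abs_dotProduct_self_sub {μ : Measure ℝ} [IsProbabilityMeasure μ]
    (hμ : MemLp id 2 μ) (hμ0 : ∫ x, x ∂μ = 0) {η : ℝ} (hη : 0 < η) :
    Tendsto (fun n : ℕ => (Measure.pi fun _ : Fin n => μ)
      {e | η * n ≤ |e ⬝ᵥ e - n * Var[id; μ]|}) atTop (𝓝 0) := by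
  have h := tendsto_measure_pi_le_abs_sum_sub (f := fun x : ℝ => id x ^ 2) (by fun_prop)
    hμ.integrable_sq hη
  rw [variance_of_integral_eq_zero aemeasurable_id hμ0]
  simpa only [dotProduct, id, sq] using h

end WeakLaw

/-! ### Consistency of the selection -/

theorem mulVec_injective_of_rank {m ι : Type*} [Finite m] [Fintype ι] {Z : Matrix m ι ℝ}
    (h : Z.rank = Fintype.card ι) : Function.Injective Z.mulVec := by
  rw [Matrix.rank_eq_finrank_span_cols] at h
  exact Matrix.mulVec_injective_iff.2 (linearIndependent_iff_card_eq_finrank_span.2 h.symm)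

theorem Layout.numParams_pos (L : Layout) : 0 < L.numParams := Fintype.card_pos

theorem Prec.eventually_lt {f g : ℕ → ℝ≥0∞} (h : Prec f g) (hf0 : ∀ᶠ n in atTop, f n ≠ 0)
    (hf : ∀ᶠ n in atTop, f n ≠ ∞) {η : ℝ} (hη : 0 < η) :
    ∀ᶠ n in atTop, f n < ENNReal.ofReal η * g n := by
  filter_upwards [h.eventually_lt_const (ENNReal.ofReal_pos.2 hη), hf0, hf] with n hn hn0 hninf
  exact (ENNReal.div_lt_iff (Or.inr hn0) (Or.inr hninf)).1 hn

/-- The assumptions of `Setting` with independent errors of an arbitrary law `μ` on the line that is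
centered and has a positive finite variance, in place of the normal law. -/
structure IIDSetting {Ω : ℕ → Type*} [∀ n, MeasurableSpace (Ω n)] (P : ∀ n, Measure (Ω n))
    (L : ℕ → Layout) (D : ∀ n, Data (L n) n) (β : ∀ n, (L n).Param → ℝ) (T : ∀ n, Model (L n))
    (μ : Measure ℝ) (ε : ∀ n, Ω n → Fin n → ℝ) (r : ℕ → ℝ) (That : ∀ n, Ω n → Model (L n)) :
    Prop where
  memLp : MemLp id 2 μ
  integral_eq_zero : ∫ x, x ∂μ = 0
  variance_pos : 0 < Var[id; μ]
  errors : ∀ n, HasLaw (ε n) (Measure.pi fun _ => μ) (P n)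
  full_rank : ∀ᶠ n in atTop, (D n).X.rank = (L n).numParams
  true_model : ∀ n, (T n).IsMinimalTrue (β n)
  true_size : ∃ K : ℕ, ∀ n, (T n).size ≤ K
  params_prec : Prec (fun n => ((L n).numParams : ℝ≥0∞)) (fun n => ENNReal.ofReal (r n))
  penalty_prec : Prec (fun n => ENNReal.ofReal (r n))
    (fun n => min (n : ℝ≥0∞) (minLoss (D n) (β n) (T n)))
  selected : ∀ n ω, IsOutput (D n) ((D n).X *ᵥ β n + ε n ω) (r n) (That n ω)
  measurable_selected : ∀ n M, MeasurableSet {ω | That n ω = M}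

section Consistency

variable {Ω : ℕ → Type*} [∀ n, MeasurableSpace (Ω n)] {P : ∀ n, Measure (Ω n)}
  {L : ℕ → Layout} {D : ∀ n, Data (L n) n} {β : ∀ n, (L n).Param → ℝ} {T : ∀ n, Model (L n)}
  {μ : Measure ℝ} {σ : ℝ} {ε : ∀ n, Ω n → Fin n → ℝ} {r : ℕ → ℝ}
  {That : ∀ n, Ω n → Model (L n)}

theorem Setting.toIIDSetting (h : Setting P L D β T σ ε r That) :
    IIDSetting P L D β T (gaussianReal 0 (σ ^ 2).toNNReal) ε r That where
  memLp := memLp_id_gaussianReal 2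
  integral_eq_zero := integral_id_gaussianReal
  variance_pos := by
    rw [variance_id_gaussianReal, NNReal.coe_pos, Real.toNNReal_pos]
    exact pow_pos h.sigma_pos 2
  errors := h.errors
  full_rank := h.full_rank
  true_model := h.true_model
  true_size := h.true_size
  params_prec := h.params_prec
  penalty_prec := h.penalty_prec
  selected := h.selected
  measurable_selected := h.measurable_selected

/-- The smaller of the sample size and the minimal loss, the scale that the penalty must not
reach. -/
noncomputable def signal (D : ∀ n, Data (L n) n) (β : ∀ n, (L n).Param → ℝ)
    (T : ∀ n, Model (L n)) (n : ℕ) : ℝ :=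
  (min (n : ℝ≥0∞) (minLoss (D n) (β n) (T n))).toReal

theorem ofReal_signal (n : ℕ) :
    ENNReal.ofReal (signal D β T n) = min (n : ℝ≥0∞) (minLoss (D n) (β n) (T n)) :=
  ENNReal.ofReal_toReal (min_lt_of_left_lt (ENNReal.natCast_lt_top n)).ne

theorem signal_le (n : ℕ) : signal D β T n ≤ n :=
  ENNReal.toReal_le_of_le_ofReal n.cast_nonneg
    ((min_le_left _ _).trans_eq (ENNReal.ofReal_natCast n).symm)

namespace IIDSetting

theorem eventually_mulVec_injective (h : IIDSetting P L D β T μ ε r That) :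
    ∀ᶠ n in atTop, Function.Injective (D n).X.mulVec :=
  h.full_rank.mono fun _ => mulVec_injective_of_rank

theorem eventually_params_lt (h : IIDSetting P L D β T μ ε r That) :
    ∀ᶠ n in atTop, ((L n).numParams : ℝ) < r n := by
  filter_upwards [h.params_prec.eventually_lt
    (Eventually.of_forall fun n => Nat.cast_ne_zero.2 (L n).numParams_pos.ne')
    (Eventually.of_forall fun _ => ENNReal.natCast_ne_top _) one_pos] with n hn
  rw [ENNReal.ofReal_one, one_mul, ← ENNReal.ofReal_natCast] at hn
  exact (ENNReal.ofReal_lt_ofReal_iff_of_nonneg (Nat.cast_nonneg _)).1 hn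

theorem eventually_penalty_pos (h : IIDSetting P L D β T μ ε r That) :
    ∀ᶠ n in atTop, 0 < r n :=
  h.eventually_params_lt.mono fun _ hn => (Nat.cast_nonneg _).trans_lt hn

theorem eventually_mul_penalty_lt (h : IIDSetting P L D β T μ ε r That) {A : ℝ} (hA : 0 < A) :
    ∀ᶠ n in atTop, A * r n < signal D β T n := by
  filter_upwards [h.penalty_prec.eventually_lt
    (h.eventually_penalty_pos.mono fun n hr => (ENNReal.ofReal_pos.2 hr).ne')
    (Eventually.of_forall fun _ => ENNReal.ofReal_ne_top) (inv_pos.2 hA),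
    h.eventually_penalty_pos] with n hn hr
  rw [← ofReal_signal, ← ENNReal.ofReal_mul (inv_pos.2 hA).le] at hn
  exact (lt_inv_mul_iff₀ hA).1 ((ENNReal.ofReal_lt_ofReal_iff_of_nonneg hr.le).1 hn)

theorem eventually_penalty_mul_size_lt (h : IIDSetting P L D β T μ ε r That) {A : ℝ}
    (hA : 0 < A) : ∀ᶠ n in atTop, r n * (T n).size < signal D β T n / A := by
  obtain ⟨K, hK⟩ := h.true_size
  filter_upwards [h.eventually_mul_penalty_lt (A := A * (K + 1)) (by positivity),
    h.eventually_penalty_pos] with n hn hr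
  have hsize : ((T n).size : ℝ) ≤ K + 1 := by
    exact_mod_cast (hK n).trans K.le_succ
  rw [lt_div_iff₀ hA]
  calc r n * (T n).size * A ≤ r n * (K + 1) * A := by gcongr
    _ = A * (K + 1) * r n := by ring
    _ < signal D β T n := hn

theorem eventually_moderateErrors (h : IIDSetting P L D β T μ ε r That) :
    ∀ᶠ n : ℕ in atTop, ∀ e : Fin n → ℝ, projSq (D n).X e < Var[id; μ] / 4 * r n →
      |e ⬝ᵥ e - n * Var[id; μ]| < Var[id; μ] / 2 * n →
      ModerateErrors (D n) (β n) (T n) (r n) (signal D β T n)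
        (Var[id; μ] / 4) (2 * Var[id; μ]) e := by
  have hv := h.variance_pos
  filter_upwards [h.eventually_mulVec_injective, h.eventually_params_lt,
    h.eventually_mul_penalty_lt one_pos,
    h.eventually_mul_penalty_lt (A := 4 * Var[id; μ]) (by positivity),
    h.eventually_penalty_mul_size_lt (A := 2 * (2 * Var[id; μ]) + 1) (by positivity)]
    with n hX hparams hpenalty hproj hsize e heproj he
  have hδn : signal D β T n ≤ n := signal_le n
  rw [abs_lt] at he
  refine ⟨hX, by positivity, ?_, hδn, ?_, hsize, ?_, heproj, ?_, ?_⟩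
  · exact_mod_cast hparams.trans (by linarith : r n < n)
  · exact (ofReal_signal n).trans_le (min_le_right _ _)
  · linarith
  · nlinarith
  · nlinarith

variable [IsProbabilityMeasure μ]

theorem eventually_measure_ne_le (h : IIDSetting P L D β T μ ε r That) :
    ∀ᶠ n : ℕ in atTop, P n {ω | That n ω ≠ T n} ≤
      4 * (((L n).numParams : ℝ≥0∞) / ENNReal.ofReal (r n)) +
      (Measure.pi fun _ : Fin n => μ)
        {e | Var[id; μ] / 2 * n ≤ |e ⬝ᵥ e - n * Var[id; μ]|} := by
  have hv := h.variance_pos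
  filter_upwards [h.eventually_moderateErrors, h.eventually_mulVec_injective,
    h.eventually_penalty_pos] with n hmod hX hr
  set B₁ : Set (Fin n → ℝ) := {e | Var[id; μ] / 4 * r n ≤ projSq (D n).X e}
  set B₂ : Set (Fin n → ℝ) := {e | Var[id; μ] / 2 * n ≤ |e ⬝ᵥ e - n * Var[id; μ]|}
  have hB₁ : MeasurableSet B₁ := measurableSet_le measurable_const (measurable_projSq _)
  have hB₂ : MeasurableSet B₂ :=
    measurableSet_le measurable_const (by simp only [dotProduct]; fun_prop)
  have hsub : {ω | That n ω ≠ T n} ⊆ {ω | ε n ω ∈ B₁} ∪ {ω | ε n ω ∈ B₂} := by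
    intro ω hω
    by_contra hcon
    simp only [B₁, B₂, Set.mem_union, Set.mem_ofPred_eq, not_or, not_le] at hcon
    exact hω ((hmod _ hcon.1 hcon.2).eq_of_isOutput (h.true_model n) (h.selected n ω))
  have hP₁ : P n {ω | ε n ω ∈ B₁} ≤
      4 * (((L n).numParams : ℝ≥0∞) / ENNReal.ofReal (r n)) := by
    rw [(h.errors n).measure_eq (p := fun e => e ∈ B₁) hB₁]
    refine (measure_le_projSq_le h.memLp h.integral_eq_zero hX (by positivity)).trans_eq ?_
    rw [← ENNReal.ofReal_natCast, ← ENNReal.ofReal_div_of_pos hr, ← ENNReal.ofReal_ofNat 4,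
      ← ENNReal.ofReal_mul (by norm_num), Layout.numParams]
    congr 1
    field_simp
  have hP₂ : P n {ω | ε n ω ∈ B₂} = (Measure.pi fun _ : Fin n => μ) B₂ :=
    (h.errors n).measure_eq (p := fun e => e ∈ B₂) hB₂
  calc P n {ω | That n ω ≠ T n} ≤ P n {ω | ε n ω ∈ B₁} + P n {ω | ε n ω ∈ B₂} :=
        (measure_mono hsub).trans (measure_union_le _ _)
    _ ≤ _ := add_le_add hP₁ hP₂.le

theorem tendsto_measure_ne (h : IIDSetting P L D β T μ ε r That) :
    Tendsto (fun n => P n {ω | That n ω ≠ T n}) atTop (𝓝 0) := by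
  refine tendsto_of_tendsto_of_tendsto_of_le_of_le' tendsto_const_nhds ?_
    (Eventually.of_forall fun _ => zero_le) h.eventually_measure_ne_le
  have hproj := ENNReal.Tendsto.const_mul (a := 4) h.params_prec (Or.inr (by simp))
  have hlength := tendsto_measure_pi_le_abs_dotProduct_self_sub h.memLp h.integral_eq_zero
    (half_pos h.variance_pos)
  simpa only [mul_zero, add_zero] using hproj.add hlength

theorem tendsto_measure_eq [∀ n, IsProbabilityMeasure (P n)]
    (h : IIDSetting P L D β T μ ε r That) :
    Tendsto (fun n => P n {ω | That n ω = T n}) atTop (𝓝 1) := by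
  have hcompl (n : ℕ) : P n {ω | That n ω = T n} = 1 - P n {ω | That n ω ≠ T n} := by
    have hprob := prob_compl_eq_one_sub (μ := P n) (h.measurable_selected n (T n)).compl
    rwa [compl_compl] at hprob
  simp_rw [hcompl]
  simpa only [tsub_zero] using
    ENNReal.Tendsto.sub tendsto_const_nhds h.tendsto_measure_ne (Or.inl ENNReal.one_ne_top)

end IIDSetting

end Consistency

/-! ### Convergence in distribution -/

section Convergence

theorem norm_integral_sub_integral_le {Ω E : Type*} [MeasurableSpace Ω] [TopologicalSpace E]
    [MeasurableSpace E] [OpensMeasurableSpace E] {P : Measure Ω} [IsFiniteMeasure P] {X Y : Ω → E}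
    (hX : AEMeasurable X P) (hY : AEMeasurable Y P) (f : BoundedContinuousFunction E ℝ) :
    ‖∫ ω, f (Y ω) ∂P - ∫ ω, f (X ω) ∂P‖ ≤ 2 * ‖f‖ * P.real {ω | X ω ≠ Y ω} := by
  have hint {Z : Ω → E} (hZ : AEMeasurable Z P) : Integrable (fun ω => f (Z ω)) P :=
    (integrable_map_measure (f.integrable _).aestronglyMeasurable hZ).1 (f.integrable _)
  set A := toMeasurable P {ω | X ω ≠ Y ω}
  have hA : ∀ ω ∉ A, f (Y ω) - f (X ω) = 0 := by
    intro ω hω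
    have hXY : X ω = Y ω := not_not.1 fun hne => hω (subset_toMeasurable P _ hne)
    rw [hXY, sub_self]
  have hbound : ∀ ω ∈ A, ‖f (Y ω) - f (X ω)‖ ≤ 2 * ‖f‖ := fun ω _ =>
    (dist_eq_norm _ _).symm.trans_le (f.dist_le_two_norm _ _)
  rw [← integral_sub (hint hY) (hint hX), ← setIntegral_eq_integral_of_forall_compl_eq_zero hA,
    measureReal_def, ← measure_toMeasurable]
  exact norm_setIntegral_le_of_norm_le_const (measure_lt_top _ _) hbound

theorem tendstoInDistribution_of_tendsto_measure_ne {κ Ω' E : Type*} {Ω : κ → Type*}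
    [∀ n, MeasurableSpace (Ω n)] [MeasurableSpace Ω'] [TopologicalSpace E] [MeasurableSpace E]
    [OpensMeasurableSpace E] {P : ∀ n, Measure (Ω n)} [∀ n, IsProbabilityMeasure (P n)]
    {P' : Measure Ω'} [IsProbabilityMeasure P'] {X Y : ∀ n, Ω n → E} {Z : Ω' → E} {l : Filter κ}
    (hX : TendstoInDistribution X l Z P P') (hY : ∀ n, AEMeasurable (Y n) (P n))
    (hXY : Tendsto (fun n => P n {ω | X n ω ≠ Y n ω}) l (𝓝 0)) :
    TendstoInDistribution Y l Z P P' where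
  forall_aemeasurable := hY
  aemeasurable_limit := hX.aemeasurable_limit
  tendsto := by
    refine ProbabilityMeasure.tendsto_iff_forall_integral_tendsto.2 fun f => ?_
    have hfX := ProbabilityMeasure.tendsto_iff_forall_integral_tendsto.1 hX.tendsto f
    have hmap {n : κ} {W : Ω n → E} (hW : AEMeasurable W (P n)) :
        ∫ x, f x ∂(P n).map W = ∫ ω, f (W ω) ∂P n :=
      integral_map hW (f.integrable _).aestronglyMeasurable
    simp only [ProbabilityMeasure.coe_mk, hmap (hX.forall_aemeasurable _), hmap (hY _)] at hfX ⊢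
    have hbound : Tendsto (fun n => 2 * ‖f‖ * (P n).real {ω | X n ω ≠ Y n ω}) l (𝓝 0) := by
      simpa only [Function.comp_def, measureReal_def, ENNReal.toReal_zero, mul_zero] using
        ((ENNReal.tendsto_toReal ENNReal.zero_ne_top).comp hXY).const_mul (2 * ‖f‖)
    have hdiff := squeeze_zero_norm (fun n => norm_integral_sub_integral_le
      (hX.forall_aemeasurable n) (hY n) f) hbound
    simpa only [sub_add_cancel, zero_add] using hdiff.add hfX

variable {ι : Type*} [Fintype ι]

theorem charFun_map_toLp_mulVec {m : Type*} [Fintype m] (μ : Measure (m → ℝ))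
    (B : Matrix ι m ℝ) (t : EuclideanSpace ℝ ι) :
    charFun (μ.map fun e => WithLp.toLp 2 (B *ᵥ e)) t =
      charFun (μ.map (WithLp.toLp 2)) (WithLp.toLp 2 (Bᵀ *ᵥ t.ofLp)) := by
  have hinner (e : m → ℝ) : inner ℝ (WithLp.toLp 2 (B *ᵥ e)) t =
      inner ℝ (WithLp.toLp 2 e) (WithLp.toLp 2 (Bᵀ *ᵥ t.ofLp)) := by
    simp only [EuclideanSpace.inner_eq_star_dotProduct, star_trivial]
    rw [dotProduct_comm, mulVec_dotProduct, dotProduct_comm]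
  rw [charFun_apply, charFun_apply, integral_map (by fun_prop) (by fun_prop),
    integral_map (by fun_prop) (by fun_prop)]
  simp_rw [hinner]

variable [DecidableEq ι]

theorem tendsto_multivariateGaussian {A : ℕ → Matrix ι ι ℝ} {B : Matrix ι ι ℝ}
    (hA : ∀ n, (A n).PosSemidef) (hB : B.PosSemidef) (h : Tendsto A atTop (𝓝 B))
    (x : EuclideanSpace ℝ ι) :
    Tendsto (β := ProbabilityMeasure (EuclideanSpace ℝ ι))
      (fun n => ⟨multivariateGaussian x (A n), inferInstance⟩) atTop
      (𝓝 ⟨multivariateGaussian x B, inferInstance⟩) := by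
  refine ProbabilityMeasure.tendsto_iff_tendsto_charFun.2 fun t => ?_
  simp only [ProbabilityMeasure.coe_mk, charFun_multivariateGaussian, hA, hB]
  have hcont : Continuous fun C : Matrix ι ι ℝ =>
      Complex.exp (inner ℝ t x * Complex.I - (t.ofLp ⬝ᵥ (C *ᵥ t.ofLp) : ℝ) / 2) := by
    simp only [dotProduct]
    fun_prop
  exact (hcont.tendsto B).comp h

theorem map_toLp_mulVec_pi_gaussianReal {m : Type*} [Fintype m] (v : ℝ≥0) (B : Matrix ι m ℝ) :
    (Measure.pi fun _ : m => gaussianReal 0 v).map (fun e => WithLp.toLp 2 (B *ᵥ e)) =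
      multivariateGaussian 0 ((v : ℝ) • (B * Bᵀ)) := by
  have hB : ((v : ℝ) • (B * Bᵀ)).PosSemidef :=
    (Matrix.posSemidef_self_mul_conjTranspose B).smul v.coe_nonneg
  have hquad (u : ι → ℝ) : u ⬝ᵥ ((B * Bᵀ) *ᵥ u) = ∑ i, (Bᵀ *ᵥ u) i ^ 2 := by
    rw [← Matrix.mulVec_mulVec, dotProduct_comm, mulVec_dotProduct]
    simp only [dotProduct, sq]
  refine Measure.ext_of_charFun (funext fun t => ?_)
  rw [charFun_map_toLp_mulVec, charFun_pi, charFun_multivariateGaussian hB, Matrix.smul_mulVec,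
    dotProduct_smul, hquad]
  simp only [charFun_gaussianReal, ← Complex.exp_sum, inner_zero_right, Complex.ofReal_zero,
    mul_zero, zero_mul, zero_sub, Finset.sum_neg_distrib, ← Finset.sum_div, smul_eq_mul]
  push_cast
  rw [Finset.mul_sum]

end Convergence

/-! ### Asymptotic normality -/

section LimitCov

variable {L : Layout} {M : Model L} {S : Matrix L.Param L.Param ℝ}

theorem Model.posDef_compress (hS : S.PosDef) : (M.A1ᵀ * S * M.A1).PosDef := by
  simpa only [Matrix.conjTranspose_eq_transpose_of_trivial] using
    hS.conjTranspose_mul_mul_same M.A1_mulVec_injective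

theorem Model.posSemidef_limitCov (hS : (M.A1ᵀ * S * M.A1).PosSemidef) :
    (M.limitCov S).PosSemidef := by
  simpa only [Model.limitCov, Matrix.conjTranspose_eq_transpose_of_trivial] using
    hS.inv.mul_mul_conjTranspose_same M.A1

theorem Model.continuousAt_limitCov (hS : IsUnit (M.A1ᵀ * S * M.A1).det) :
    ContinuousAt M.limitCov S := by
  have hcompress : Continuous fun B : Matrix L.Param L.Param ℝ => M.A1ᵀ * B * M.A1 := by fun_prop
  have hexpand : Continuous fun B : Matrix M.Free M.Free ℝ => M.A1 * B * M.A1ᵀ := by fun_prop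
  have hinv : ContinuousAt Inv.inv (M.A1ᵀ * S * M.A1) :=
    continuousAt_matrix_inv _ (NormedRing.inverse_continuousAt hS.unit)
  exact hexpand.continuousAt.comp
    (ContinuousAt.comp (f := fun B => M.A1ᵀ * B * M.A1) hinv hcompress.continuousAt)

end LimitCov

section ErrorMap

variable {L : Layout} {n : ℕ} {D : Data L n} {T : Model L}

/-- The matrix that maps the error vector to the estimation error in the true model `T`, scaled by
`√n`. -/
noncomputable def errorMap (D : Data L n) (T : Model L) : Matrix L.Param (Fin n) ℝ :=
  Real.sqrt n • (T.A1 * ((Z1 D T)ᵀ * Z1 D T)⁻¹ * (Z1 D T)ᵀ)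

theorem sqrt_smul_betaHat_sub (hX : Function.Injective D.X.mulVec) {β : L.Param → ℝ}
    (hβ : β ∈ T.space) (e : Fin n → ℝ) :
    Real.sqrt n • (betaHat D (D.X *ᵥ β + e) T - β) = errorMap D T *ᵥ e := by
  obtain ⟨u, rfl⟩ := T.exists_A1_mulVec_eq hβ
  have hbetaHat : betaHat D (D.X *ᵥ (T.A1 *ᵥ u) + e) T =
      T.A1 *ᵥ u + T.A1 *ᵥ lsq (Z1 D T) e := by
    rw [← Matrix.mulVec_add, ← Z1_mulVec]
    change T.A1 *ᵥ lsq (Z1 D T) (Z1 D T *ᵥ u + e) = _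
    rw [lsq_add, lsq_mulVec (Z1_mulVec_injective hX T)]
  rw [hbetaHat, add_sub_cancel_left, errorMap, Matrix.smul_mulVec, lsq, Matrix.mulVec_mulVec,
    Matrix.mulVec_mulVec]

theorem errorMap_mul_transpose (hX : Function.Injective D.X.mulVec) (hn : n ≠ 0) :
    errorMap D T * (errorMap D T)ᵀ = T.limitCov ((n : ℝ)⁻¹ • (D.Xᵀ * D.X)) := by
  set G := (Z1 D T)ᵀ * Z1 D T with hG
  have hn' : (n : ℝ) ≠ 0 := Nat.cast_ne_zero.2 hn
  have hdet : IsUnit G.det := isUnit_det_gram (Z1_mulVec_injective hX T)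
  have hcompress : T.A1ᵀ * ((n : ℝ)⁻¹ • (D.Xᵀ * D.X)) * T.A1 = (n : ℝ)⁻¹ • G := by
    simp only [hG, Z1, Matrix.transpose_mul, Matrix.mul_smul, Matrix.smul_mul, Matrix.mul_assoc]
  have hinv : ((n : ℝ)⁻¹ • G)⁻¹ = (n : ℝ) • G⁻¹ := by
    refine Matrix.inv_eq_right_inv ?_
    rw [Matrix.smul_mul, Matrix.mul_smul, smul_smul, inv_mul_cancel₀ hn', one_smul,
      Matrix.mul_nonsing_inv _ hdet]
  have hsymm : (G⁻¹)ᵀ = G⁻¹ := by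
    rw [Matrix.transpose_nonsing_inv, hG, Matrix.transpose_mul, Matrix.transpose_transpose]
  calc errorMap D T * (errorMap D T)ᵀ
      = (n : ℝ) • (T.A1 * (G⁻¹ * G) * (G⁻¹ * T.A1ᵀ)) := by
        simp only [errorMap, ← hG, Matrix.transpose_smul, Matrix.transpose_mul,
          Matrix.transpose_transpose, hsymm, Matrix.smul_mul, Matrix.mul_smul, smul_smul,
          Real.mul_self_sqrt n.cast_nonneg]
        simp only [hG, Matrix.mul_assoc]
    _ = (n : ℝ) • (T.A1 * G⁻¹ * T.A1ᵀ) := by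
        rw [Matrix.nonsing_inv_mul _ hdet, Matrix.mul_one, Matrix.mul_assoc]
    _ = T.limitCov ((n : ℝ)⁻¹ • (D.Xᵀ * D.X)) := by
        rw [Model.limitCov, hcompress, hinv, Matrix.mul_smul, Matrix.smul_mul]

theorem map_toLp_errorMap {Ω : Type*} [MeasurableSpace Ω] {P : Measure Ω} {v : ℝ≥0}
    {ε : Ω → Fin n → ℝ} (hε : HasLaw ε (Measure.pi fun _ => gaussianReal 0 v) P) :
    P.map (fun ω => WithLp.toLp 2 (errorMap D T *ᵥ ε ω)) =
      multivariateGaussian 0 ((v : ℝ) • (errorMap D T * (errorMap D T)ᵀ)) := by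
  rw [← map_toLp_mulVec_pi_gaussianReal, ← hε.map_eq,
    AEMeasurable.map_map_of_aemeasurable (by fun_prop) hε.aemeasurable, Function.comp_def]

end ErrorMap

section SelectedEstimator

theorem aemeasurable_select {Ω ι E G : Type*} [MeasurableSpace Ω] [MeasurableSpace E]
    [MeasurableSpace G] [Countable ι] {P : Measure Ω} {s : Ω → ι} {F : ι → E → G} {X : Ω → E}
    (hs : ∀ i, MeasurableSet {ω | s ω = i}) (hF : ∀ i, Measurable (F i)) (hX : AEMeasurable X P) :
    AEMeasurable (fun ω => F (s ω) (X ω)) P := by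
  let _ : MeasurableSpace ι := ⊤
  have hs' : Measurable s := measurable_to_countable' hs
  have hF' : Measurable fun q : ι × E => F q.1 q.2 := measurable_from_prod_countable_right hF
  exact hF'.comp_aemeasurable (hs'.aemeasurable.prodMk hX)

theorem continuous_betaHat {L : Layout} {n : ℕ} (D : Data L n) (M : Model L) :
    Continuous fun y => betaHat D y M := by
  unfold betaHat
  fun_prop

variable {Ω : ℕ → Type*} [∀ n, MeasurableSpace (Ω n)] {P : ∀ n, Measure (Ω n)}
  {L : Layout} {D : ∀ n, Data L n} {β : ℕ → L.Param → ℝ} {T : Model L} {μ : Measure ℝ} {v : ℝ≥0}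
  {ε : ∀ n, Ω n → Fin n → ℝ} {r : ℕ → ℝ} {That : ∀ n, Ω n → Model L}
  {S : Matrix L.Param L.Param ℝ}

/-- The estimation error in the selected model, scaled by `√n`. -/
noncomputable def scaledError (D : ∀ n, Data L n) (β : ℕ → L.Param → ℝ)
    (ε : ∀ n, Ω n → Fin n → ℝ) (That : ∀ n, Ω n → Model L) (n : ℕ) (ω : Ω n) :
    EuclideanSpace ℝ L.Param :=
  WithLp.toLp 2 (Real.sqrt n • (betaHat (D n) ((D n).X *ᵥ β n + ε n ω) (That n ω) - β n))

namespace IIDSetting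

theorem aemeasurable_scaledError (h : IIDSetting P (fun _ => L) D β (fun _ => T) μ ε r That)
    (n : ℕ) : AEMeasurable (scaledError D β ε That n) (P n) := by
  refine aemeasurable_select (F := fun M e => (WithLp.toLp 2 (Real.sqrt n •
      (betaHat (D n) ((D n).X *ᵥ β n + e) M - β n)) : EuclideanSpace ℝ L.Param))
    (h.measurable_selected n) (fun M => Continuous.measurable ?_) (h.errors n).aemeasurable
  have hcont := continuous_betaHat (D n) M
  fun_prop

theorem tendstoInDistribution_errorMap [∀ n, IsProbabilityMeasure (P n)]
    (h : IIDSetting P (fun _ => L) D β (fun _ => T) (gaussianReal 0 v) ε r That)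
    (hS : (T.A1ᵀ * S * T.A1).PosDef)
    (hXX : Tendsto (fun n : ℕ => (n : ℝ)⁻¹ • ((D n).Xᵀ * (D n).X)) atTop (𝓝 S)) :
    TendstoInDistribution
      (fun n ω => (WithLp.toLp 2 (errorMap (D n) T *ᵥ ε n ω) : EuclideanSpace ℝ L.Param))
      atTop id P (multivariateGaussian 0 ((v : ℝ) • T.limitCov S)) where
  forall_aemeasurable n := by
    have hε := (h.errors n).aemeasurable
    fun_prop
  tendsto := by
    have hcov : Tendsto (fun n => (v : ℝ) • (errorMap (D n) T * (errorMap (D n) T)ᵀ)) atTop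
        (𝓝 ((v : ℝ) • T.limitCov S)) := by
      refine Tendsto.const_smul (Tendsto.congr' ?_
        ((Model.continuousAt_limitCov hS.det_pos.ne'.isUnit).tendsto.comp hXX)) _
      filter_upwards [h.eventually_mulVec_injective, eventually_ne_atTop 0] with n hX hn
      exact (errorMap_mul_transpose hX hn).symm
    have hpsd (n : ℕ) : ((v : ℝ) • (errorMap (D n) T * (errorMap (D n) T)ᵀ)).PosSemidef :=
      (Matrix.posSemidef_self_mul_conjTranspose _).smul v.coe_nonneg
    simpa only [map_toLp_errorMap (h.errors _), Measure.map_id] using tendsto_multivariateGaussian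
      hpsd ((Model.posSemidef_limitCov hS.posSemidef).smul v.coe_nonneg) hcov 0

theorem tendsto_measure_errorMap_ne [IsProbabilityMeasure μ]
    (h : IIDSetting P (fun _ => L) D β (fun _ => T) μ ε r That) :
    Tendsto (fun n => P n {ω | (WithLp.toLp 2 (errorMap (D n) T *ᵥ ε n ω) :
      EuclideanSpace ℝ L.Param) ≠ scaledError D β ε That n ω}) atTop (𝓝 0) := by
  refine tendsto_of_tendsto_of_tendsto_of_le_of_le' tendsto_const_nhds h.tendsto_measure_ne
    (Eventually.of_forall fun _ => zero_le) ?_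
  filter_upwards [h.eventually_mulVec_injective] with n hX
  refine measure_mono fun ω hω hsel => hω ?_
  rw [scaledError, hsel, sqrt_smul_betaHat_sub hX (h.true_model n).1]

theorem tendstoInDistribution_scaledError [∀ n, IsProbabilityMeasure (P n)]
    (h : IIDSetting P (fun _ => L) D β (fun _ => T) (gaussianReal 0 v) ε r That)
    (hS : (T.A1ᵀ * S * T.A1).PosDef)
    (hXX : Tendsto (fun n : ℕ => (n : ℝ)⁻¹ • ((D n).Xᵀ * (D n).X)) atTop (𝓝 S)) :
    TendstoInDistribution (scaledError D β ε That) atTop id P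
      (multivariateGaussian 0 ((v : ℝ) • T.limitCov S)) :=
  tendstoInDistribution_of_tendsto_measure_ne (h.tendstoInDistribution_errorMap hS hXX)
    h.aemeasurable_scaledError h.tendsto_measure_errorMap_ne

end IIDSetting

end SelectedEstimator

end DMR

theorem theorem1_general {Ω : ℕ → Type*} [∀ n, MeasurableSpace (Ω n)] (P : ∀ n, Measure (Ω n))
    [∀ n, IsProbabilityMeasure (P n)] (ε : ∀ n, Ω n → Fin n → ℝ) (r : ℕ → ℝ) :
    (∀ (L : ℕ → DMR.Layout) (D : ∀ n, DMR.Data (L n) n) (β : ∀ n, (L n).Param → ℝ)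
      (T : ∀ n, DMR.Model (L n)) (μ : Measure ℝ) [IsProbabilityMeasure μ]
      (That : ∀ n, Ω n → DMR.Model (L n)),
      DMR.IIDSetting P L D β T μ ε r That →
      Tendsto (fun n => P n {ω | That n ω = T n}) atTop (𝓝 1)) ∧
    (∀ (L : DMR.Layout) (D : ∀ n, DMR.Data L n) (β : ℕ → L.Param → ℝ) (T : DMR.Model L)
      (v : ℝ≥0) (That : ∀ n, Ω n → DMR.Model L) (S : Matrix L.Param L.Param ℝ),
      DMR.IIDSetting P (fun _ => L) D β (fun _ => T) (gaussianReal 0 v) ε r That →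
      (T.A1ᵀ * S * T.A1).PosDef →
      Tendsto (fun n : ℕ => (n : ℝ)⁻¹ • ((D n).Xᵀ * (D n).X)) atTop (𝓝 S) →
      TendstoInDistribution (DMR.scaledError D β ε That) atTop id P
        (multivariateGaussian 0 ((v : ℝ) • T.limitCov S))) :=
  ⟨fun _ _ _ _ _ _ _ h => h.tendsto_measure_eq,
    fun _ _ _ _ _ _ _ h hS hXX => h.tendstoInDistribution_scaledError hS hXX⟩

/-- (a) The selected model is the true model with probability tending to one. (b) If moreover the
layout (hence `p`) and the true model do not depend on `n` and `Xᵀ X / n` converges to a positive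
definite `S`, then the estimator in the selected model is asymptotically normal. -/
theorem theorem1 {Ω : ℕ → Type*} [∀ n, MeasurableSpace (Ω n)] (P : ∀ n, Measure (Ω n))
    [∀ n, IsProbabilityMeasure (P n)] (σ : ℝ) (ε : ∀ n, Ω n → Fin n → ℝ) (r : ℕ → ℝ) :
    (∀ (L : ℕ → DMR.Layout) (D : ∀ n, DMR.Data (L n) n) (β : ∀ n, (L n).Param → ℝ)
      (T : ∀ n, DMR.Model (L n)) (That : ∀ n, Ω n → DMR.Model (L n)),
      DMR.Setting P L D β T σ ε r That →
      Tendsto (fun n => P n {ω | That n ω = T n}) atTop (𝓝 1)) ∧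
    (∀ (L : DMR.Layout) (D : ∀ n, DMR.Data L n) (β : ℕ → L.Param → ℝ) (T : DMR.Model L)
      (That : ∀ n, Ω n → DMR.Model L) (S : Matrix L.Param L.Param ℝ),
      DMR.Setting P (fun _ => L) D β (fun _ => T) σ ε r That →
      S.PosDef →
      Tendsto (fun n : ℕ => (n : ℝ)⁻¹ • ((D n).Xᵀ * (D n).X)) atTop (𝓝 S) →
      TendstoInDistribution
        (fun (n : ℕ) ω => WithLp.toLp 2 (Real.sqrt n •
          (DMR.betaHat (D n) ((D n).X *ᵥ β n + ε n ω) (That n ω) - β n)))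
        atTop id P (multivariateGaussian 0 (σ ^ 2 • T.limitCov S))) := by
  obtain ⟨hselection, hnormality⟩ := theorem1_general P ε r
  refine ⟨fun L D β T That h => hselection L D β T _ That h.toIIDSetting,
    fun L D β T That S h hS hXX => ?_⟩
  have hlimit := hnormality L D β T _ That S h.toIIDSetting (DMR.Model.posDef_compress hS) hXX
  rwa [Real.coe_toNNReal _ (sq_nonneg σ)] at hlimit
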